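/- **Setting.** Let $p,n_e\ge 1$ and let $\Theta\subseteq\mathbb R^p$ be closed and convex. Data points are $\mathbf d=(\mathbf x,y)$ with $\mathbf x\in\mathbb R^p$, and $l(\boldsymbol\theta|\mathbf d)=\varphi_y(\mathbf x^{T}\boldsymbol\theta)$, where each $\varphi_y:\mathbb R\to\mathbb R$ is convex and twice continuously differentiable. The observations $\mathbf d_1,\dots,\mathbf d_n$ are i.i.d. from a law under which almost surely $\|\mathbf x\|_2\le\zeta_1$ and $\|\nabla l(\boldsymbol\theta|\mathbf d)\|_2<\zeta_2$ for all $\boldsymbol\theta\in\Theta$, and $l(\boldsymbol\theta|\mathbf d)$ is integrable for every $\boldsymbol\theta\in\Theta$. Let $L(\boldsymbol\theta)=\mathbb E\big(n^{-1}\sum_{i=1}^n l(\boldsymbol\theta|\mathbf d_i)\big)$, and let $\boldsymbol\theta^0$ minimize $L$ over $\Theta$. Let $l''>0$ be the second derivative at $0$ of $\varphi_e$, the same for the outcome $e$ of each of the $n_e$ augmented rows. In iteration $t\ge 1$ let $V^{(t)}_1,\dots,V^{(t)}_p>0$ be the variances of the regularization noise: fixed numbers for $t=1$, and a fixed positive function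 of the previous estimate $\hat{\boldsymbol\theta}^{(t-1)*}$ for $t\ge2$. Put $V^{(t)}_{(1)}=\min_jV^{(t)}_j$ and $R^{(t)}(\boldsymbol\theta)=\tfrac12 n_el''\sum_{j=1}^pV^{(t)}_j\theta_j^2$, and let $\hat{\boldsymbol\theta}^{(t)*}$ minimize over $\Theta$ $$n^{-1}\Big(\sum_{i=1}^n l(\boldsymbol\theta|\mathbf d_i)+\sum_{j=1}^p b_j\theta_j+R^{(t)}(\boldsymbol\theta)\Big).$$ The privacy noise $\mathbf b$ is independent of the data and the same in all iterations. With $\varepsilon>0$ and $r\in(0,1)$, it is in one of two regimes: ($\varepsilon$-DP) $\mathbf b$ has density proportional to $\exp(-(\zeta_1\zeta_2)^{-1}r\varepsilon\|\mathbf b\|_2)$; or ($(\varepsilon,\delta)$-DP, $\delta\in(0,1)$) $\mathbf b\sim N\big(\mathbf 0,\,2(r\varepsilon)^{-2}\zeta_1^2\zeta_2^2(r\varepsilon-\log\delta)I_p\big)$. **Theorem (sample complexity of NAPP-ERM).** For all $\zeta_1,\zeta_2>0$ and $\bar\pi\in(0,1)$ there is a constant $C'>0$, depending only on $\zeta_1,\zeta_2,\bar\pi$,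 such that the following holds for every $\pi'\in(0,\bar\pi]$, every $\pi\in(0,1)$ (with $\pi\le\frac12$ in the $(\varepsilon,\delta)$-DP regime), every $t\ge1$ and every $\varrho>0$. Let $$C=2\big(p\,\zeta_1\zeta_2(r\varepsilon)^{-1}\log(p/\pi)\big)^2\quad\text{for }\varepsilon\text{-DP},\qquad C=4p\,\zeta_1^2\zeta_2^2(r\varepsilon)^{-2}\big(r\varepsilon+\log(2/\delta)\big)\log(1/\pi)\quad\text{for }(\varepsilon,\delta)\text{-DP}.$$ If $\varrho+C'\log(\pi')\big(2n_el''V^{(t)}_{(1)}\big)^{-1}>0$ and $$n>\Big(\varrho+\frac{C'\log \pi'}{2n_el''V^{(t)}_{(1)}}\Big)^{-1}\Big(R^{(t)}(\boldsymbol\theta^0)+\frac{C}{n_el''V^{(t)}_{(1)}}\Big),$$ then $L(\hat{\boldsymbol\theta}^{(t)*})\le L(\boldsymbol\theta^0)+\varrho$ with probability at least $1-\pi-\pi'$. For $t\ge2$, where the $V^{(t)}_j$ and hence the threshold are random, this means: there is an event of probability at least $1-\pi-\pi'$ on which the two displayed conditions imply $L(\hat{\boldsymbol\theta}^{(t)*})\le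 L(\boldsymbol\theta^0)+\varrho$. -/

import Mathlib

open MeasureTheory ProbabilityTheory

namespace NAPP

noncomputable section

/-- Parameter and predictor space: `ℝ^p` with the Euclidean norm. -/
abbrev Vec (p : ℕ) : Type := EuclideanSpace ℝ (Fin p)

/-- One-data-point loss `l(θ | d)` for `d = (x, y)`: a function `φ y` of the linear predictor
`η = ⟨x, θ⟩`. -/
def loss {p : ℕ} {Y : Type*} (φ : Y → ℝ → ℝ) (θ : Vec p) (d : Vec p × Y) : ℝ :=
  φ d.2 (inner ℝ d.1 θ)

/-- Expected loss `L(θ) = E (n⁻¹ ∑ l(θ | d_i))` for `n` independent data points of law `μ`. -/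
def expectedLoss {p : ℕ} {Y : Type*} [MeasurableSpace Y] (φ : Y → ℝ → ℝ)
    (μ : Measure (Vec p × Y)) (n : ℕ) (θ : Vec p) : ℝ :=
  ∫ D : Fin n → Vec p × Y, (n : ℝ)⁻¹ * ∑ i, loss φ θ (D i) ∂(Measure.pi fun _ => μ)

/-- The regularizer `R^{(t)}(θ) = 2⁻¹ n_e l'' ∑ V_j θ_j²` with regularization-noise variances
`V_j`. -/
def regularizer {p : ℕ} (ne : ℕ) (l2 : ℝ) (V : Fin p → ℝ) (θ : Vec p) : ℝ :=
  2⁻¹ * (ne * l2) * ∑ j, V j * θ j ^ 2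

/-- The modulus `n_e l'' V_(1)`, with `V_(1)` the smallest of the variances. -/
def modulus {p : ℕ} (ne : ℕ) (l2 : ℝ) (V : Fin p → ℝ) : ℝ :=
  ne * l2 * ⨅ j, V j

/-- The private objective
`J_p^{(t)priv}(θ | D) = n⁻¹ (∑ l(θ | d_i) + ∑ b_j θ_j + R^{(t)}(θ))`. -/
def privObjective {p n : ℕ} {Y : Type*} (φ : Y → ℝ → ℝ) (D : Fin n → Vec p × Y) (b : Vec p)
    (ne : ℕ) (l2 : ℝ) (V : Fin p → ℝ) (θ : Vec p) : ℝ :=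
  (n : ℝ)⁻¹ * (∑ i, loss φ θ (D i) + ∑ j, b j * θ j + regularizer ne l2 V θ)

/-- Variances of the regularization noise in iteration `s` (iterations are counted from `1`):
`V₁` in the first iteration, and `V` evaluated at the previous estimate afterwards. -/
def iterVariance {p : ℕ} (V₁ : Fin p → ℝ) (V : Vec p → Fin p → ℝ) (est : ℕ → Vec p) (s : ℕ) :
    Fin p → ℝ :=
  if s ≤ 1 then V₁ else V (est (s - 1))

/-- `est 1, …, est t` are the private estimates of the first `t` iterations on the data `D`, all
with the same privacy noise `b`: each minimizes over `Θ` the private objective whose variances are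
computed from the previous estimate. -/
def IsRun {p n : ℕ} {Y : Type*} (Θ : Set (Vec p)) (φ : Y → ℝ → ℝ) (D : Fin n → Vec p × Y)
    (b : Vec p) (ne : ℕ) (l2 : ℝ) (V₁ : Fin p → ℝ) (V : Vec p → Fin p → ℝ) (t : ℕ)
    (est : ℕ → Vec p) : Prop :=
  ∀ s, 1 ≤ s → s ≤ t → est s ∈ Θ ∧
    IsMinOn (privObjective φ D b ne l2 (iterVariance V₁ V est s)) Θ (est s)

/-- Noise for pure `ε`-privacy, the spherical Laplace distribution: density on `ℝ^p` proportional
to `exp (-(ζ₁ ζ₂)⁻¹ (r ε) ‖b‖)`. -/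
def laplaceNoise (p : ℕ) (ζ₁ ζ₂ r ε : ℝ) : Measure (Vec p) :=
  (volume : Measure (Vec p)).withDensity fun b =>
    ENNReal.ofReal (Real.exp (-((ζ₁ * ζ₂)⁻¹ * (r * ε) * ‖b‖)) /
      ∫ x : Vec p, Real.exp (-((ζ₁ * ζ₂)⁻¹ * (r * ε) * ‖x‖)))

/-- Noise for `(ε, δ)`-privacy: `N(0, 2 (r ε)⁻² ζ₁² ζ₂² (r ε - log δ) I_p)`. -/
def gaussianNoise (p : ℕ) (ζ₁ ζ₂ r ε δ : ℝ) : Measure (Vec p) :=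
  multivariateGaussian 0
    ((2 * ((r * ε) ^ 2)⁻¹ * ζ₁ ^ 2 * ζ₂ ^ 2 * (r * ε - Real.log δ)) •
      (1 : Matrix (Fin p) (Fin p) ℝ))

/-- The constant `C` for `ε`-privacy. -/
def laplaceConst (p : ℕ) (ζ₁ ζ₂ r ε π : ℝ) : ℝ :=
  2 * (p * ζ₁ * ζ₂ * (r * ε)⁻¹ * Real.log (p * π⁻¹)) ^ 2

/-- The constant `C` for `(ε, δ)`-privacy. -/
def gaussianConst (p : ℕ) (ζ₁ ζ₂ r ε δ π : ℝ) : ℝ :=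
  4 * p * ζ₁ ^ 2 * ζ₂ ^ 2 * ((r * ε) ^ 2)⁻¹ * (r * ε + Real.log (2 / δ)) * Real.log π⁻¹

end

end NAPP

namespace NAPP

/-! Two events carry the probability: the noise satisfies `‖b‖² ≤ 1.95 C`, and the excess empirical
loss does not fall below the excess expected loss by more than `nϱ/200 + K‖θ - θ₀‖²/(1000ϱ)` for any
`θ ∈ Θ`, where `K = -C' log π'`. A union bound combines them. Neither event mentions the variances,
so it does not matter that those of iteration `t` depend on data and noise.

On both events the rest is deterministic (`deviation_of_excess`). Strong convexity at the minimizer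
yields the gain `R(θ - θ₀)`, which absorbs `⟨b, θ - θ₀⟩` by Young's inequality at a cost below
`C/m`, with `m` the modulus. If the excess loss exceeded `ϱ`, the sample size condition would then
force a deviation beyond the allowed one; positivity of `ϱ - K/(2m)` makes the quadratic part of the
allowance smaller than what is left of `R(θ - θ₀)`.

The deviation bound (`measure_pi_excess_deviation_le`) must hold on an unbounded `Θ` with a constant
free of `p`. Instead of covering or peeling, the exponential moment of the supremum of the process
minus a quadratic penalty is bounded by induction on the sample (`lintegral_pi_iSup_exp_le`): each
data point is symmetrized, and the loss is replaced by a linear functional through contraction. The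
noise bounds are a Gamma tail and a chi-square tail with explicit constants. -/

/-! ### Symmetrization and contraction under the exponential. -/

/-- Weak majorization of two points, for the increasing convex function `exp`. -/
theorem exp_add_exp_le_of_add_le {u v A B : ℝ} (h : u + v ≤ A + B) (hu : u ≤ max A B)
    (hv : v ≤ max A B) : Real.exp u + Real.exp v ≤ Real.exp A + Real.exp B := by
  wlog hAB : B ≤ A generalizing A B
  · rw [add_comm (Real.exp A)]
    exact this (by linarith) (by rwa [max_comm]) (by rwa [max_comm]) (le_of_not_ge hAB)
  wlog huv : v ≤ u generalizing u v
  · rw [add_comm (Real.exp u)]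
    exact this (by linarith) hv hu (le_of_not_ge huv)
  rw [max_eq_left hAB] at hu hv
  by_cases hvB : v ≤ B
  · exact add_le_add (Real.exp_le_exp.2 hu) (Real.exp_le_exp.2 hvB)
  have hv' : Real.exp v = Real.exp B * Real.exp (v - B) := by rw [← Real.exp_add]; ring_nf
  have hA' : Real.exp A = Real.exp u * Real.exp (A - u) := by rw [← Real.exp_add]; ring_nf
  have h1 : Real.exp (v - B) ≤ Real.exp (A - u) := Real.exp_le_exp.2 (by linarith)
  have h2 : 1 ≤ Real.exp (v - B) := Real.one_le_exp (by linarith)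
  have h3 : Real.exp B ≤ Real.exp u := Real.exp_le_exp.2 (by linarith)
  have h4 : Real.exp B * (Real.exp (v - B) - 1) ≤ Real.exp u * (Real.exp (A - u) - 1) :=
    mul_le_mul h3 (by linarith) (by linarith) (Real.exp_pos u).le
  rw [hv', hA']
  linarith

/-- One step of the contraction principle, with an arbitrary offset `a`. -/
theorem iSup_exp_add_iSup_exp_le {ι : Type*} [Nonempty ι] (a f g : ι → ℝ)
    (hfg : ∀ i j, |f i - f j| ≤ |g i - g j|) (hf : ∀ i, |f i| ≤ |g i|) :
    (⨆ i, ENNReal.ofReal (Real.exp (a i + f i))) + (⨆ i, ENNReal.ofReal (Real.exp (a i - f i))) ≤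
      (⨆ i, ENNReal.ofReal (Real.exp (a i + g i))) +
        (⨆ i, ENNReal.ofReal (Real.exp (a i - g i))) := by
  refine ENNReal.iSup_add_iSup_le fun i j => ?_
  have hM : ∀ k, ENNReal.ofReal (Real.exp (a k + g k)) ≤
      ⨆ i, ENNReal.ofReal (Real.exp (a i + g i)) :=
    fun k => le_iSup (fun i => ENNReal.ofReal (Real.exp (a i + g i))) k
  have hm : ∀ k, ENNReal.ofReal (Real.exp (a k - g k)) ≤
      ⨆ i, ENNReal.ofReal (Real.exp (a i - g i)) :=
    fun k => le_iSup (fun i => ENNReal.ofReal (Real.exp (a i - g i))) k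
  -- The two maxima sum to at least `a i + a j + |g i - g j|`, and the larger one dominates each
  -- exponent on the left because `|f| ≤ |g|`: this is weak majorization.
  have key : Real.exp (a i + f i) + Real.exp (a j - f j) ≤
      Real.exp (max (a i + g i) (a j + g j)) + Real.exp (max (a i - g i) (a j - g j)) := by
    have e1 := le_max_left (a i + g i) (a j + g j)
    have e2 := le_max_right (a i + g i) (a j + g j)
    have e3 := le_max_left (a i - g i) (a j - g j)
    have e4 := le_max_right (a i - g i) (a j - g j)
    have h1 := (le_abs_self _).trans (hfg i j)
    have h2 := (le_abs_self _).trans (hf i)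
    have h3 := (neg_le_abs _).trans (hf j)
    refine exp_add_exp_le_of_add_le ?_ ?_ ?_
    · rcases abs_cases (g i - g j) with h | h <;> linarith
    · rcases abs_cases (g i) with h | h
      · exact le_max_of_le_left (by linarith)
      · exact le_max_of_le_right (by linarith)
    · rcases abs_cases (g j) with h | h
      · exact le_max_of_le_left (by linarith)
      · exact le_max_of_le_right (by linarith)
  rw [← ENNReal.ofReal_add (Real.exp_pos _).le (Real.exp_pos _).le]
  refine (ENNReal.ofReal_le_ofReal key).trans ?_
  rw [ENNReal.ofReal_add (Real.exp_pos _).le (Real.exp_pos _).le]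
  refine add_le_add ?_ ?_
  · rcases max_choice (a i + g i) (a j + g j) with h | h <;> rw [h] <;> exact hM _
  · rcases max_choice (a i - g i) (a j - g j) with h | h <;> rw [h] <;> exact hm _

/-- Separates the mean from the sample in the symmetrization, in place of an independent copy and
random signs. -/
theorem ofReal_exp_add_le_half (x y : ℝ) :
    ENNReal.ofReal (Real.exp (x + y)) ≤
      2⁻¹ * (ENNReal.ofReal (Real.exp (2 * x)) + ENNReal.ofReal (Real.exp (2 * y))) := by
  have h2 : (2⁻¹ : ENNReal) = ENNReal.ofReal 2⁻¹ := by
    rw [ENNReal.ofReal_inv_of_pos two_pos]; simp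
  rw [← ENNReal.ofReal_add (Real.exp_pos _).le (Real.exp_pos _).le, h2,
    ← ENNReal.ofReal_mul (by norm_num)]
  refine ENNReal.ofReal_le_ofReal ?_
  rw [Real.exp_add, two_mul, two_mul, Real.exp_add, Real.exp_add]
  nlinarith [sq_nonneg (Real.exp x - Real.exp y)]

theorem ofReal_exp_integral_le {X : Type*} [MeasurableSpace X] {μ : Measure X}
    [IsProbabilityMeasure μ] {f : X → ℝ} (hf : Integrable f μ) :
    ENNReal.ofReal (Real.exp (∫ x, f x ∂μ)) ≤ ∫⁻ x, ENNReal.ofReal (Real.exp (f x)) ∂μ := by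
  by_cases hi : Integrable (fun x => Real.exp (f x)) μ
  · rw [← ofReal_integral_eq_lintegral_ofReal hi (ae_of_all _ fun x => (Real.exp_pos _).le)]
    exact ENNReal.ofReal_le_ofReal (convexOn_exp.map_integral_le Real.continuous_exp.continuousOn
      isClosed_univ (by simp) hf hi)
  · have : ∫⁻ x, ENNReal.ofReal (Real.exp (f x)) ∂μ = ⊤ := by
      by_contra h
      refine hi ⟨Real.continuous_exp.comp_aestronglyMeasurable hf.1, ?_⟩
      rw [hasFiniteIntegral_iff_ofReal (ae_of_all _ fun x => (Real.exp_pos _).le)]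
      exact lt_top_iff_ne_top.2 h
    rw [this]; exact le_top

/-- Symmetrization and contraction in a single variable, with an arbitrary offset `a`. -/
theorem lintegral_iSup_exp_le {ι X : Type*} [Countable ι] [Nonempty ι] [MeasurableSpace X]
    {μ : Measure X} [IsProbabilityMeasure μ] (a : ι → ℝ) (f g : ι → X → ℝ)
    (hf : ∀ i, Measurable (f i)) (hfi : ∀ i, Integrable (f i) μ)
    (hfg : ∀ᵐ x ∂μ, (∀ i j, |f i x - f j x| ≤ |g i x - g j x|) ∧ ∀ i, |f i x| ≤ |g i x|) :
    ∫⁻ x, ⨆ i, ENNReal.ofReal (Real.exp (a i + (∫ y, f i y ∂μ - f i x))) ∂μ ≤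
      ∫⁻ x, 2⁻¹ * ((⨆ i, ENNReal.ofReal (Real.exp (a i + 2 * g i x))) +
        ⨆ i, ENNReal.ofReal (Real.exp (a i - 2 * g i x))) ∂μ := by
  have hm1 : Measurable fun x => ⨆ i, ENNReal.ofReal (Real.exp (a i + 2 * f i x)) :=
    Measurable.iSup fun i => by have := hf i; fun_prop
  have hm2 : Measurable fun x => ⨆ i, ENNReal.ofReal (Real.exp (a i - 2 * f i x)) :=
    Measurable.iSup fun i => by have := hf i; fun_prop
  have hmean : ∀ i, ENNReal.ofReal (Real.exp (a i + 2 * ∫ y, f i y ∂μ)) ≤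
      ∫⁻ y, ⨆ i, ENNReal.ofReal (Real.exp (a i + 2 * f i y)) ∂μ := by
    intro i
    have h := ofReal_exp_integral_le (f := fun y => 2 * f i y + a i)
      (((hfi i).const_mul 2).add (integrable_const (a i)))
    have e : ∫ y, (2 * f i y + a i) ∂μ = a i + 2 * ∫ y, f i y ∂μ := by
      rw [integral_add ((hfi i).const_mul 2) (integrable_const _), integral_const_mul]
      simp [add_comm]
    rw [e] at h
    refine h.trans (lintegral_mono fun y => ?_)
    rw [add_comm]
    exact le_iSup (fun i => ENNReal.ofReal (Real.exp (a i + 2 * f i y))) i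
  calc ∫⁻ x, ⨆ i, ENNReal.ofReal (Real.exp (a i + (∫ y, f i y ∂μ - f i x))) ∂μ
      ≤ ∫⁻ x, 2⁻¹ * ((∫⁻ y, ⨆ i, ENNReal.ofReal (Real.exp (a i + 2 * f i y)) ∂μ) +
        ⨆ i, ENNReal.ofReal (Real.exp (a i - 2 * f i x))) ∂μ := by
        refine lintegral_mono fun x => iSup_le fun i => ?_
        -- The offset is split evenly, so that each half recovers the full `a i` after doubling; the
        -- mean is then removed by Jensen's inequality.
        have h := ofReal_exp_add_le_half (a i / 2 + ∫ y, f i y ∂μ) (a i / 2 - f i x)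
        rw [show a i / 2 + ∫ y, f i y ∂μ + (a i / 2 - f i x) = a i + (∫ y, f i y ∂μ - f i x) by ring,
          show 2 * (a i / 2 + ∫ y, f i y ∂μ) = a i + 2 * ∫ y, f i y ∂μ by ring,
          show 2 * (a i / 2 - f i x) = a i - 2 * f i x by ring] at h
        refine h.trans (mul_le_mul_right (add_le_add (hmean i) ?_) _)
        exact le_iSup (fun i => ENNReal.ofReal (Real.exp (a i - 2 * f i x))) i
    _ = ∫⁻ x, 2⁻¹ * ((⨆ i, ENNReal.ofReal (Real.exp (a i + 2 * f i x))) +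
        ⨆ i, ENNReal.ofReal (Real.exp (a i - 2 * f i x))) ∂μ := by
        rw [lintegral_const_mul _ (by exact hm2.const_add _),
          lintegral_const_mul _ (by exact hm1.add hm2),
          lintegral_add_left measurable_const, lintegral_add_left hm1]
        simp
    _ ≤ _ := by
        refine lintegral_mono_ae (hfg.mono fun x hx => mul_le_mul_right ?_ _)
        refine iSup_exp_add_iSup_exp_le a (fun i => 2 * f i x) (fun i => 2 * g i x)
          (fun i j => ?_) (fun i => ?_)
        · simp only [← mul_sub, abs_mul]
          exact mul_le_mul_of_nonneg_left (hx.1 i j) (abs_nonneg _)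
        · simp only [abs_mul]
          exact mul_le_mul_of_nonneg_left (hx.2 i) (abs_nonneg _)

/-! ### Exponential moment of the penalized empirical process. -/

/-- Averaging over the sign turns the cross term into a `cosh`, and `cosh x ≤ exp (x² / 2)` costs
`2‖S‖²/D²`. Lowering `D` by 2 pays for it, since `1/D + 2/D² ≤ 1/(D - 2)`. -/
theorem half_exp_norm_add_sq_le {E : Type*} [NormedAddCommGroup E] [InnerProductSpace ℝ E]
    (S z : E) (hz : ‖z‖ ≤ 1) {D c : ℝ} (hD : 2 < D) :
    2⁻¹ * (Real.exp (c + ‖S + z‖ ^ 2 / D) + Real.exp (c + ‖S - z‖ ^ 2 / D)) ≤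
      Real.exp (c + 1 / D + ‖S‖ ^ 2 / (D - 2)) := by
  have hD0 : 0 < D := by linarith
  set w := inner ℝ S z with hw
  have hplus : ‖S + z‖ ^ 2 = ‖S‖ ^ 2 + 2 * w + ‖z‖ ^ 2 := norm_add_sq_real S z
  have hminus : ‖S - z‖ ^ 2 = ‖S‖ ^ 2 - 2 * w + ‖z‖ ^ 2 := norm_sub_sq_real S z
  have hwle : w ^ 2 ≤ ‖S‖ ^ 2 := by
    have h := abs_real_inner_le_norm S z
    rw [← hw] at h
    have : |w| ≤ ‖S‖ := h.trans (mul_le_of_le_one_right (norm_nonneg _) hz)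
    rw [← sq_abs]
    exact pow_le_pow_left₀ (abs_nonneg _) this 2
  have hz2 : ‖z‖ ^ 2 ≤ 1 := pow_le_one₀ (norm_nonneg _) hz
  have e : 2⁻¹ * (Real.exp (c + ‖S + z‖ ^ 2 / D) + Real.exp (c + ‖S - z‖ ^ 2 / D)) =
      Real.exp (c + (‖S‖ ^ 2 + ‖z‖ ^ 2) / D) * Real.cosh (2 * w / D) := by
    rw [hplus, hminus, Real.cosh_eq,
      show c + (‖S‖ ^ 2 + 2 * w + ‖z‖ ^ 2) / D = c + (‖S‖ ^ 2 + ‖z‖ ^ 2) / D + 2 * w / D by ring,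
      show c + (‖S‖ ^ 2 - 2 * w + ‖z‖ ^ 2) / D = c + (‖S‖ ^ 2 + ‖z‖ ^ 2) / D + -(2 * w / D) by ring,
      Real.exp_add _ (2 * w / D), Real.exp_add _ (-(2 * w / D))]
    ring
  rw [e]
  refine (mul_le_mul_of_nonneg_left (Real.cosh_le_exp_half_sq _) (Real.exp_pos _).le).trans ?_
  rw [← Real.exp_add]
  refine Real.exp_le_exp.2 ?_
  have h1 : (2 * w / D) ^ 2 / 2 ≤ 2 * ‖S‖ ^ 2 / D ^ 2 := by
    rw [div_pow, div_div, div_le_div_iff₀ (by positivity) (by positivity)]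
    nlinarith [mul_le_mul_of_nonneg_right hwle (sq_nonneg D)]
  have h2 : (‖S‖ ^ 2 + ‖z‖ ^ 2) / D ≤ ‖S‖ ^ 2 / D + 1 / D := by
    rw [← add_div]; gcongr
  have h3 : 1 / D + 2 / D ^ 2 ≤ 1 / (D - 2) := by
    have hD2 : 0 < D - 2 := by linarith
    rw [div_add_div _ _ hD0.ne' (by positivity), div_le_div_iff₀ (by positivity) hD2]
    nlinarith
  have h4 : ‖S‖ ^ 2 / D + 2 * ‖S‖ ^ 2 / D ^ 2 ≤ ‖S‖ ^ 2 / (D - 2) := by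
    have := mul_le_mul_of_nonneg_left h3 (sq_nonneg ‖S‖)
    calc _ = ‖S‖ ^ 2 * (1 / D + 2 / D ^ 2) := by ring
      _ ≤ _ := this
      _ = _ := by ring
  linarith

/-- Exponential moment of the offset empirical process indexed by a countable class that is a
contraction of a class of linear functionals with features `z` in the unit ball. -/
theorem lintegral_pi_iSup_exp_le {ι X E : Type*} [Countable ι] [Nonempty ι] [MeasurableSpace X]
    [NormedAddCommGroup E] [InnerProductSpace ℝ E] [MeasurableSpace E] [BorelSpace E]
    [SecondCountableTopology E]
    {μ : Measure X} [IsProbabilityMeasure μ] (f : ι → X → ℝ) (z : X → E) (v : ι → E)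
    (hf : ∀ i, Measurable (f i)) (hfi : ∀ i, Integrable (f i) μ) (hz : Measurable z)
    (hz1 : ∀ x, ‖z x‖ ≤ 1)
    (hfg : ∀ᵐ x ∂μ, (∀ i j, |f i x - f j x| ≤ |inner ℝ (z x) (v i) - inner ℝ (z x) (v j)|) ∧
      ∀ i, |f i x| ≤ |inner ℝ (z x) (v i)|) (N : ℕ) (hN : 0 < N) (k : ℕ) (hk : k ≤ N) (S : E) :
    ∫⁻ ω : Fin k → X, ⨆ i, ENNReal.ofReal (Real.exp (2 * inner ℝ S (v i) - 4 * N * ‖v i‖ ^ 2 +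
        ∑ j, (∫ y, f i y ∂μ - f i (ω j)))) ∂(Measure.pi fun _ => μ) ≤
      ENNReal.ofReal (Real.exp (k / (2 * N) + ‖S‖ ^ 2 / (4 * N - 2 * k))) := by
  have hN' : (0 : ℝ) < N := by exact_mod_cast hN
  induction k generalizing S with
  | zero =>
    -- Without data points only `2⟨S, v⟩ - 4N‖v‖²` remains, which is at most `‖S‖²/(4N)` by
    -- completing the square.
    rw [lintegral_unique]
    simp only [Finset.univ_eq_empty, Finset.sum_empty, measure_univ, mul_one]
    refine iSup_le fun i => ENNReal.ofReal_le_ofReal (Real.exp_le_exp.2 ?_)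
    have h : 2 * inner ℝ S (v i) ≤ 2 * (‖S‖ * ‖v i‖) := by
      linarith [real_inner_le_norm S (v i)]
    have h2 : ‖S‖ ^ 2 / (4 * N) - 2 * (‖S‖ * ‖v i‖) + 4 * N * ‖v i‖ ^ 2 =
        (‖S‖ - 4 * N * ‖v i‖) ^ 2 / (4 * N) := by
      field_simp
      ring
    have h3 : 0 ≤ (‖S‖ - 4 * N * ‖v i‖) ^ 2 / (4 * N) := by positivity
    simp only [CharP.cast_eq_zero, zero_div, mul_zero, sub_zero, zero_add, add_zero]
    linarith
  | succ k ih =>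
    have hk' : k ≤ N := by omega
    have hkN : (k : ℝ) + 1 ≤ N := by exact_mod_cast hk
    have hmeas : ∀ S : E, Measurable fun q : X × (Fin k → X) =>
        ⨆ i, ENNReal.ofReal (Real.exp (2 * inner ℝ S (v i) - 4 * N * ‖v i‖ ^ 2 +
          ∑ j, (∫ y, f i y ∂μ - f i (q.2 j)) + (∫ y, f i y ∂μ - f i q.1))) := fun S =>
      Measurable.iSup fun i => by have := hf i; fun_prop
    have hmeas' : ∀ s : ℝ, Measurable fun q : X × (Fin k → X) =>
        ⨆ i, ENNReal.ofReal (Real.exp (2 * inner ℝ (S + s • z q.1) (v i) - 4 * N * ‖v i‖ ^ 2 +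
          ∑ j, (∫ y, f i y ∂μ - f i (q.2 j)))) := fun s =>
      Measurable.iSup fun i => by have := hf i; fun_prop
    have hmp := (measurePreserving_piFinSuccAbove (fun _ : Fin (k + 1) => μ) 0).symm
    rw [← hmp.lintegral_comp_emb (MeasurableEquiv.measurableEmbedding _)]
    have e1 : ∀ q : X × (Fin k → X),
        (⨆ i, ENNReal.ofReal (Real.exp (2 * inner ℝ S (v i) - 4 * N * ‖v i‖ ^ 2 +
          ∑ j, (∫ y, f i y ∂μ - f i ((MeasurableEquiv.piFinSuccAbove (fun _ => X) 0).symm q j))))) =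
        ⨆ i, ENNReal.ofReal (Real.exp (2 * inner ℝ S (v i) - 4 * N * ‖v i‖ ^ 2 +
          ∑ j, (∫ y, f i y ∂μ - f i (q.2 j)) + (∫ y, f i y ∂μ - f i q.1))) := by
      intro q
      refine iSup_congr fun i => ?_
      rw [Fin.sum_univ_succ]
      simp only [MeasurableEquiv.piFinSuccAbove_symm_apply, Fin.insertNthEquiv_apply,
        Fin.insertNth_zero, Fin.cons_zero, Fin.cons_succ, cast_eq]
      congr 2
      ring
    simp_rw [e1]
    -- The new point is integrated first, the others entering as offset. After contraction it only
    -- shifts `S` to `S ± z x`, so the order is swapped and the induction hypothesis applies for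
    -- each fixed `x`.
    rw [lintegral_prod_symm' _ (hmeas S)]
    calc ∫⁻ ω : Fin k → X, ∫⁻ x, ⨆ i, ENNReal.ofReal (Real.exp
          (2 * inner ℝ S (v i) - 4 * N * ‖v i‖ ^ 2 + ∑ j, (∫ y, f i y ∂μ - f i (ω j)) +
            (∫ y, f i y ∂μ - f i x))) ∂μ ∂(Measure.pi fun _ => μ)
        ≤ ∫⁻ ω : Fin k → X, ∫⁻ x, 2⁻¹ * ((⨆ i, ENNReal.ofReal (Real.exp
          (2 * inner ℝ (S + (1 : ℝ) • z x) (v i) - 4 * N * ‖v i‖ ^ 2 +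
            ∑ j, (∫ y, f i y ∂μ - f i (ω j))))) + ⨆ i, ENNReal.ofReal (Real.exp
          (2 * inner ℝ (S + (-1 : ℝ) • z x) (v i) - 4 * N * ‖v i‖ ^ 2 +
            ∑ j, (∫ y, f i y ∂μ - f i (ω j))))) ∂μ ∂(Measure.pi fun _ => μ) := by
          refine lintegral_mono fun ω => ?_
          refine (lintegral_iSup_exp_le _ f (fun i x => inner ℝ (z x) (v i)) hf hfi hfg).trans_eq ?_
          refine lintegral_congr fun x => ?_
          simp only [inner_add_left, inner_smul_left]
          congr 2
          · refine iSup_congr fun i => ?_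
            congr 2
            simp
            ring
          · refine iSup_congr fun i => ?_
            congr 2
            simp
            ring
      _ = ∫⁻ x, 2⁻¹ * ((∫⁻ ω : Fin k → X, ⨆ i, ENNReal.ofReal (Real.exp
          (2 * inner ℝ (S + (1 : ℝ) • z x) (v i) - 4 * N * ‖v i‖ ^ 2 +
            ∑ j, (∫ y, f i y ∂μ - f i (ω j)))) ∂(Measure.pi fun _ => μ)) +
          ∫⁻ ω : Fin k → X, ⨆ i, ENNReal.ofReal (Real.exp
          (2 * inner ℝ (S + (-1 : ℝ) • z x) (v i) - 4 * N * ‖v i‖ ^ 2 +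
            ∑ j, (∫ y, f i y ∂μ - f i (ω j)))) ∂(Measure.pi fun _ => μ)) ∂μ := by
          rw [lintegral_lintegral_swap]
          · refine lintegral_congr fun x => ?_
            have m1 := (hmeas' 1).comp (measurable_prodMk_left (x := x))
            have m2 := (hmeas' (-1)).comp (measurable_prodMk_left (x := x))
            rw [lintegral_const_mul _ (by exact m1.add m2), lintegral_add_left (by exact m1)]
          · exact ((((hmeas' 1).add (hmeas' (-1))).comp measurable_swap).const_mul _).aemeasurable
      _ ≤ ∫⁻ _ : X, ENNReal.ofReal (Real.exp ((k + 1 : ℕ) / (2 * N) +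
            ‖S‖ ^ 2 / (4 * N - 2 * (k + 1 : ℕ)))) ∂μ := by
          refine lintegral_mono fun x => ?_
          refine (mul_le_mul_right (add_le_add (ih hk' _) (ih hk' _)) _).trans ?_
          have h2 : (2⁻¹ : ENNReal) = ENNReal.ofReal 2⁻¹ := by
            rw [ENNReal.ofReal_inv_of_pos two_pos]; simp
          rw [← ENNReal.ofReal_add (Real.exp_pos _).le (Real.exp_pos _).le, h2,
            ← ENNReal.ofReal_mul (by norm_num)]
          refine ENNReal.ofReal_le_ofReal ?_
          -- The denominator starts at `4N` and loses 2 per point, so it stays at least `2N`; each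
          -- step therefore adds at most `1/(2N)` to the exponent.
          have hD : 2 * (N : ℝ) + 2 ≤ 4 * N - 2 * k := by linarith
          have h := half_exp_norm_add_sq_le S (z x) (hz1 x) (D := 4 * N - 2 * k)
            (c := k / (2 * N)) (by linarith)
          simp only [one_smul, neg_smul, ← sub_eq_add_neg]
          refine h.trans (Real.exp_le_exp.2 ?_)
          have h3 : 1 / (4 * (N : ℝ) - 2 * k) ≤ 1 / (2 * N) :=
            one_div_le_one_div_of_le (by linarith) (by linarith)
          push_cast
          rw [add_div, show 4 * (N : ℝ) - 2 * (k + 1) = 4 * N - 2 * k - 2 by ring]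
          linarith
      _ = _ := by simp

/-- With high probability, the whole offset empirical process is bounded. -/
theorem measure_pi_exists_lt_le {ι X E : Type*} [Countable ι] [MeasurableSpace X]
    [NormedAddCommGroup E] [InnerProductSpace ℝ E] [MeasurableSpace E] [BorelSpace E]
    [SecondCountableTopology E]
    {μ : Measure X} [IsProbabilityMeasure μ] (f : ι → X → ℝ) (z : X → E) (v : ι → E)
    (hf : ∀ i, Measurable (f i)) (hfi : ∀ i, Integrable (f i) μ) (hz : Measurable z)
    (hz1 : ∀ x, ‖z x‖ ≤ 1)
    (hfg : ∀ᵐ x ∂μ, (∀ i j, |f i x - f j x| ≤ |inner ℝ (z x) (v i) - inner ℝ (z x) (v j)|) ∧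
      ∀ i, |f i x| ≤ |inner ℝ (z x) (v i)|) (N : ℕ) (hN : 0 < N) (s : ℝ) :
    (Measure.pi fun _ : Fin N => μ) {ω | ∃ i, s + 4 * N * ‖v i‖ ^ 2 <
      ∑ j, (∫ y, f i y ∂μ - f i (ω j))} ≤ ENNReal.ofReal (Real.exp (1 / 2 - s)) := by
  rcases isEmpty_or_nonempty ι with hι | hι
  · simp
  -- With `S = 0` and `k = N` the moment is at most `exp (1/2)`; Markov's inequality gives the tail.
  have h := lintegral_pi_iSup_exp_le f z v hf hfi hz hz1 hfg N hN N le_rfl 0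
  have hN' : (N : ℝ) ≠ 0 := by positivity
  have hm : Measurable fun ω : Fin N → X => ⨆ i, ENNReal.ofReal (Real.exp
      (2 * inner ℝ (0 : E) (v i) - 4 * N * ‖v i‖ ^ 2 + ∑ j, (∫ y, f i y ∂μ - f i (ω j)))) :=
    Measurable.iSup fun i => by have := hf i; fun_prop
  have hs0 : ENNReal.ofReal (Real.exp s) ≠ 0 := by simp [Real.exp_pos]
  have hM := meas_ge_le_lintegral_div (μ := Measure.pi fun _ : Fin N => μ) hm.aemeasurable hs0
    ENNReal.ofReal_ne_top
  refine (measure_mono ?_).trans (hM.trans ?_)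
  · rintro ω ⟨i, hi⟩
    refine le_trans (ENNReal.ofReal_le_ofReal (Real.exp_le_exp.2 ?_)) (le_iSup (fun i =>
      ENNReal.ofReal (Real.exp (2 * inner ℝ (0 : E) (v i) - 4 * N * ‖v i‖ ^ 2 +
        ∑ j, (∫ y, f i y ∂μ - f i (ω j))))) i)
    simp only [inner_zero_left]
    linarith
  · rw [ENNReal.div_le_iff hs0 ENNReal.ofReal_ne_top, ← ENNReal.ofReal_mul (Real.exp_pos _).le,
      ← Real.exp_add]
    refine h.trans (ENNReal.ofReal_le_ofReal (Real.exp_le_exp.2 ?_))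
    simp only [norm_zero]
    field_simp
    simp

/-! ### Uniform deviation of the excess loss. -/

theorem norm_gradient_loss {p : ℕ} {Y : Type*} {φ : Y → ℝ → ℝ} (d : Vec p × Y)
    (hφ : Differentiable ℝ (φ d.2)) (θ : Vec p) :
    ‖gradient (fun θ' => loss φ θ' d) θ‖ = |deriv (φ d.2) (inner ℝ d.1 θ)| * ‖d.1‖ := by
  have h1 : HasFDerivAt (fun θ' : Vec p => inner ℝ d.1 θ') (innerSL ℝ d.1) θ :=
    (innerSL ℝ d.1).hasFDerivAt
  have h2 := (hφ (inner ℝ d.1 θ)).hasDerivAt.comp_hasFDerivAt θ h1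
  have h3 : HasGradientAt (fun θ' => loss φ θ' d) (deriv (φ d.2) (inner ℝ d.1 θ) • d.1) θ := by
    rw [hasGradientAt_iff_hasFDerivAt]
    have e : InnerProductSpace.toDual ℝ (Vec p) (deriv (φ d.2) (inner ℝ d.1 θ) • d.1) =
        deriv (φ d.2) (inner ℝ d.1 θ) • (innerSL ℝ) d.1 := by
      ext w
      simp
    rw [e]
    exact h2
  rw [h3.gradient, norm_smul, Real.norm_eq_abs]

/-- The loss depends on `θ` through a `c`-Lipschitz function of the normalized predictor. -/
theorem abs_loss_sub_loss_le {p : ℕ} {Y : Type*} {φ : Y → ℝ → ℝ} {Θ : Set (Vec p)} {c : ℝ}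
    (hΘ : Convex ℝ Θ) (d : Vec p × Y) (hφ : Differentiable ℝ (φ d.2))
    (hd : ∀ θ ∈ Θ, ‖gradient (fun θ' => loss φ θ' d) θ‖ < c) {θ θ' : Vec p}
    (hθ : θ ∈ Θ) (hθ' : θ' ∈ Θ) :
    |loss φ θ d - loss φ θ' d| ≤ c * |inner ℝ (‖d.1‖⁻¹ • d.1) (θ - θ')| := by
  -- Here the loss is constant in `θ`, and the normalized feature is 0 since `0⁻¹ = 0`.
  by_cases hx : d.1 = 0
  · simp [loss, hx]
  have hx' : 0 < ‖d.1‖ := norm_pos_iff.2 hx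
  -- The gradient bound controls the derivative only at predictors attained on `Θ`; convexity makes
  -- them an interval, where the mean value inequality applies.
  set s : Set ℝ := (fun w : Vec p => inner ℝ d.1 w) '' Θ with hs
  have hconv : Convex ℝ s := hΘ.linear_image (innerSL ℝ d.1).toLinearMap
  have hbound : ∀ η ∈ s, ‖deriv (φ d.2) η‖ ≤ c * ‖d.1‖⁻¹ := by
    rintro _ ⟨w, hw, rfl⟩
    have h := hd w hw
    rw [norm_gradient_loss d hφ] at h
    rw [← div_eq_mul_inv, le_div_iff₀ hx']
    exact h.le
  have h := hconv.norm_image_sub_le_of_norm_deriv_le (fun η _ => hφ η) hbound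
    (Set.mem_image_of_mem _ hθ') (Set.mem_image_of_mem _ hθ)
  rw [inner_smul_left, inner_sub_right, abs_mul]
  simp only [Real.norm_eq_abs] at h
  simpa [loss, mul_assoc] using h

theorem measurable_loss {p : ℕ} {Y : Type*} [MeasurableSpace Y] {φ : Y → ℝ → ℝ}
    (hφ : ∀ y, Continuous (φ y)) (hm : ∀ η, Measurable fun y => φ y η) (θ : Vec p) :
    Measurable (loss φ θ) := by
  have h : Measurable (Function.uncurry fun (η : ℝ) (y : Y) => φ y η) :=
    measurable_uncurry_of_continuous_of_measurable hφ hm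
  exact h.comp ((by fun_prop : Measurable fun d : Vec p × Y => inner ℝ d.1 θ).prodMk measurable_snd)

theorem expectedLoss_eq_integral {p n : ℕ} {Y : Type*} [MeasurableSpace Y] {φ : Y → ℝ → ℝ}
    {μ : Measure (Vec p × Y)} [IsProbabilityMeasure μ] (hn : 0 < n) {θ : Vec p}
    (hθ : Integrable (loss φ θ) μ) : expectedLoss φ μ n θ = ∫ d, loss φ θ d ∂μ := by
  have hn' : (n : ℝ) ≠ 0 := by positivity
  rw [expectedLoss, integral_const_mul, integral_finsetSum]
  · simp_rw [integral_comp_eval (μ := fun _ : Fin n => μ) hθ.1]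
    simp [hn']
  · intro i _
    exact integrable_comp_eval (μ := fun _ : Fin n => μ) hθ

/-- Uniform one-sided deviation of the excess empirical loss from the excess expected loss, over an
unbounded parameter set and at all distances from `θ₀`. -/
theorem measure_pi_excess_deviation_le {p n : ℕ} {Y : Type*} [MeasurableSpace Y] {φ : Y → ℝ → ℝ}
    {Θ : Set (Vec p)} (hΘ : Convex ℝ Θ) (hφ : ∀ y, Differentiable ℝ (φ y))
    (hm : ∀ η, Measurable fun y => φ y η) {μ : Measure (Vec p × Y)} [IsProbabilityMeasure μ]
    {c : ℝ} (hc : 0 < c)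
    (hμ : ∀ᵐ d ∂μ, ∀ θ ∈ Θ, ‖gradient (fun θ' => loss φ θ' d) θ‖ < c)
    (hint : ∀ θ ∈ Θ, Integrable (loss φ θ) μ) {θ₀ : Vec p} (hθ₀ : θ₀ ∈ Θ) (hn : 0 < n)
    {η : ℝ} (hη : 0 < η) (s : ℝ) :
    (Measure.pi fun _ : Fin n => μ) {D | ∃ θ ∈ Θ, s / η + 4 * n * η * c ^ 2 * ‖θ - θ₀‖ ^ 2 <
      n * (∫ d, loss φ θ d ∂μ - ∫ d, loss φ θ₀ d ∂μ) -
        (∑ j, loss φ θ (D j) - ∑ j, loss φ θ₀ (D j))} ≤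
      ENNReal.ofReal (Real.exp (1 / 2 - s)) := by
  have hne : Nonempty Θ := ⟨⟨θ₀, hθ₀⟩⟩
  set q : ℕ → Θ := TopologicalSpace.denseSeq Θ with hq
  have hLip : ∀ θ ∈ Θ, ∀ θ' ∈ Θ,
      |∫ d, loss φ θ d ∂μ - ∫ d, loss φ θ' d ∂μ| ≤ c * ‖θ - θ'‖ := by
    intro θ hθ θ' hθ'
    rw [← integral_sub (hint θ hθ) (hint θ' hθ'), ← Real.norm_eq_abs]
    refine (norm_integral_le_of_norm_le_const (C := c * ‖θ - θ'‖) ?_).trans (by simp)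
    filter_upwards [hμ] with d hd
    refine (abs_loss_sub_loss_le hΘ d (hφ d.2) hd hθ hθ').trans ?_
    refine mul_le_mul_of_nonneg_left ?_ hc.le
    refine (abs_real_inner_le_norm _ _).trans (mul_le_of_le_one_left (norm_nonneg _) ?_)
    rw [norm_smul, norm_inv, norm_norm]
    exact inv_mul_le_one
  have hcont : Continuous fun θ : Θ => ∫ d, loss φ θ d ∂μ := by
    refine (LipschitzWith.of_dist_le_mul (K := c.toNNReal) fun θ θ' => ?_).continuous
    rw [Real.dist_eq, Real.coe_toNNReal _ hc.le, Subtype.dist_eq, dist_eq_norm]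
    exact hLip θ θ.2 θ' θ'.2
  -- Scaling the class by `η` trades the constant part `s/η` of the allowance against its quadratic
  -- part, which is proportional to `η`.
  have hF := measure_pi_exists_lt_le (μ := μ) (fun i d => η * (loss φ (q i : Vec p) d - loss φ θ₀ d))
    (fun d => ‖d.1‖⁻¹ • d.1) (fun i => (η * c) • ((q i : Vec p) - θ₀))
    (fun i => ((measurable_loss (fun y => (hφ y).continuous) hm _).sub
      (measurable_loss (fun y => (hφ y).continuous) hm _)).const_mul _)
    (fun i => ((hint _ (q i).2).sub (hint _ hθ₀)).const_mul _)
    (by fun_prop) (fun d => by rw [norm_smul, norm_inv, norm_norm]; exact inv_mul_le_one) ?_ n hn s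
  · refine (measure_mono ?_).trans hF
    rintro D ⟨θ, hθ, hlt⟩
    have hloss : ∀ d : Vec p × Y, Continuous fun θ : Θ => loss φ (θ : Vec p) d := fun d =>
      (hφ d.2).continuous.comp (by fun_prop)
    -- A strict violation is an open condition on `θ`, so it already occurs along the dense
    -- sequence.
    have hopen : IsOpen {θ : Θ | s / η + 4 * n * η * c ^ 2 * ‖(θ : Vec p) - θ₀‖ ^ 2 <
        n * (∫ d, loss φ θ d ∂μ - ∫ d, loss φ θ₀ d ∂μ) -
        (∑ j, loss φ θ (D j) - ∑ j, loss φ θ₀ (D j))} := by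
      refine isOpen_lt (by fun_prop) ?_
      exact (continuous_const.mul (hcont.sub continuous_const)).sub
        ((continuous_finsetSum _ fun j _ => hloss (D j)).sub continuous_const)
    obtain ⟨i, hi⟩ := (TopologicalSpace.denseRange_denseSeq Θ).exists_mem_open hopen
      ⟨⟨θ, hθ⟩, hlt⟩
    refine ⟨i, ?_⟩
    have hi' : s / η + 4 * n * η * c ^ 2 * ‖(q i : Vec p) - θ₀‖ ^ 2 <
        n * (∫ d, loss φ (q i) d ∂μ - ∫ d, loss φ θ₀ d ∂μ) -
        (∑ j, loss φ (q i) (D j) - ∑ j, loss φ θ₀ (D j)) := hi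
    have hsum : ∑ j, η * (loss φ (q i : Vec p) (D j) - loss φ θ₀ (D j)) =
        η * (∑ j, loss φ (q i : Vec p) (D j) - ∑ j, loss φ θ₀ (D j)) := by
      rw [← Finset.mul_sum, Finset.sum_sub_distrib]
    rw [integral_const_mul, integral_sub (hint _ (q i).2) (hint _ hθ₀), norm_smul,
      Real.norm_eq_abs, abs_of_pos (mul_pos hη hc), Finset.sum_sub_distrib, hsum]
    simp only [Finset.sum_const, Finset.card_univ, Fintype.card_fin, nsmul_eq_mul]
    have h := mul_lt_mul_of_pos_left hi' hη
    have e : η * (s / η + 4 * n * η * c ^ 2 * ‖(q i : Vec p) - θ₀‖ ^ 2) =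
        s + 4 * n * (η * c * ‖(q i : Vec p) - θ₀‖) ^ 2 := by
      field_simp
    rw [e] at h
    linarith
  · filter_upwards [hμ] with d hd
    refine ⟨fun i j => ?_, fun i => ?_⟩
    · have h := mul_le_mul_of_nonneg_left
        (abs_loss_sub_loss_le hΘ d (hφ d.2) hd (q i).2 (q j).2) hη.le
      rw [← mul_sub, abs_mul, abs_of_pos hη, sub_sub_sub_cancel_right, ← inner_sub_right,
        ← smul_sub, sub_sub_sub_cancel_right, inner_smul_right, abs_mul,
        abs_of_pos (mul_pos hη hc), mul_assoc]
      exact h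
    · have h := mul_le_mul_of_nonneg_left
        (abs_loss_sub_loss_le hΘ d (hφ d.2) hd (q i).2 hθ₀) hη.le
      rw [abs_mul, abs_of_pos hη, inner_smul_right, abs_mul,
        abs_of_pos (mul_pos hη hc), mul_assoc]
      exact h

/-! ### Tail of the spherical Laplace noise. -/

theorem hasDerivAt_sum_pow_div_factorial (m : ℕ) (y : ℝ) :
    HasDerivAt (fun y : ℝ => ∑ k ∈ Finset.range (m + 1), y ^ k / (k.factorial : ℝ))
      (∑ k ∈ Finset.range m, y ^ k / (k.factorial : ℝ)) y := by
  induction m with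
  | zero => simpa using hasDerivAt_const y (1 : ℝ)
  | succ m ih =>
    have h : HasDerivAt (fun y : ℝ => y ^ (m + 1) / ((m + 1).factorial : ℝ))
        (y ^ m / (m.factorial : ℝ)) y := by
      refine ((hasDerivAt_pow (m + 1) y).div_const _).congr_deriv ?_
      rw [Nat.factorial_succ]
      have : (m.factorial : ℝ) ≠ 0 := by positivity
      push_cast
      field_simp
    have h2 := ih.add h
    rw [Finset.sum_range_succ]
    refine h2.congr_of_eventuallyEq (Filter.Eventually.of_forall fun z => ?_)
    simp only [Pi.add_apply]
    rw [Finset.sum_range_succ _ (m + 1)]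

/-- The antiderivative from repeated integration by parts: in the product rule everything cancels
but the top term of the sum. -/
theorem hasDerivAt_gamma_primitive (m : ℕ) {κ : ℝ} (hκ : 0 < κ) (y : ℝ) :
    HasDerivAt (fun y : ℝ => -((m.factorial : ℝ) / κ ^ (m + 1) * (Real.exp (-(κ * y)) *
      ∑ k ∈ Finset.range (m + 1), (κ * y) ^ k / (k.factorial : ℝ))))
      (y ^ m * Real.exp (-(κ * y))) y := by
  have hl : HasDerivAt (fun y : ℝ => κ * y) κ y := by simpa using (hasDerivAt_id y).const_mul κ
  have h1 : HasDerivAt (fun y : ℝ => Real.exp (-(κ * y))) (Real.exp (-(κ * y)) * -κ) y := hl.neg.exp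
  have h2 := (hasDerivAt_sum_pow_div_factorial m (κ * y)).comp y hl
  refine ((h1.mul h2).const_mul ((m.factorial : ℝ) / κ ^ (m + 1))).neg.congr_deriv ?_
  have hm : (m.factorial : ℝ) ≠ 0 := by positivity
  simp only [Function.comp_apply, Finset.sum_range_succ, mul_pow]
  field_simp
  ring

theorem tendsto_gamma_primitive (m : ℕ) {κ : ℝ} (hκ : 0 < κ) :
    Filter.Tendsto (fun y : ℝ => -((m.factorial : ℝ) / κ ^ (m + 1) * (Real.exp (-(κ * y)) *
      ∑ k ∈ Finset.range (m + 1), (κ * y) ^ k / (k.factorial : ℝ)))) Filter.atTop (nhds 0) := by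
  have h1 : Filter.Tendsto (fun y : ℝ => Real.exp (-y) *
      ∑ k ∈ Finset.range (m + 1), y ^ k / (k.factorial : ℝ)) Filter.atTop (nhds 0) := by
    simp_rw [Finset.mul_sum]
    rw [← Finset.sum_const_zero (s := Finset.range (m + 1))]
    refine tendsto_finsetSum _ fun k _ => ?_
    have h := (Real.tendsto_pow_mul_exp_neg_atTop_nhds_zero k).div_const (k.factorial : ℝ)
    rw [zero_div] at h
    exact h.congr fun y => by ring
  have h2 := h1.comp (Filter.tendsto_id.const_mul_atTop hκ)
  simpa using (h2.const_mul ((m.factorial : ℝ) / κ ^ (m + 1))).neg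

theorem integrableOn_pow_mul_exp_neg (m : ℕ) {κ : ℝ} (hκ : 0 < κ) {a : ℝ} (ha : 0 ≤ a) :
    IntegrableOn (fun y : ℝ => y ^ m * Real.exp (-(κ * y))) (Set.Ioi a) :=
  integrableOn_Ioi_deriv_of_nonneg' (fun y _ => hasDerivAt_gamma_primitive m hκ y)
    (fun _ hy => mul_nonneg (pow_nonneg (ha.trans (Set.mem_Ioi.1 hy).le) _) (Real.exp_pos _).le)
    (tendsto_gamma_primitive m hκ)

/-- The incomplete Gamma function at positive integers. -/
theorem integral_Ioi_pow_mul_exp_neg (m : ℕ) {κ : ℝ} (hκ : 0 < κ) {a : ℝ} (ha : 0 ≤ a) :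
    ∫ y in Set.Ioi a, y ^ m * Real.exp (-(κ * y)) = (m.factorial : ℝ) / κ ^ (m + 1) *
      (Real.exp (-(κ * a)) * ∑ k ∈ Finset.range (m + 1), (κ * a) ^ k / (k.factorial : ℝ)) := by
  rw [integral_Ioi_of_hasDerivAt_of_nonneg' (fun y _ => hasDerivAt_gamma_primitive m hκ y)
    (fun _ hy => mul_nonneg (pow_nonneg (ha.trans (Set.mem_Ioi.1 hy).le) _) (Real.exp_pos _).le)
    (tendsto_gamma_primitive m hκ)]
  ring

/-- Bernoulli: `(1 - 1/(m+1))^k ≥ 1 - k/(m+1) ≥ 1/(m+1)`. -/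
theorem succ_pow_le_succ_mul_pow {m k : ℕ} (hk : k ≤ m) :
    ((m : ℝ) + 1) ^ k ≤ (m + 1) * (m : ℝ) ^ k := by
  have hm : (0 : ℝ) < m + 1 := by positivity
  have hk' : (k : ℝ) ≤ m := by exact_mod_cast hk
  have h := one_add_mul_le_pow (a := -(1 / ((m : ℝ) + 1))) (by
    have : 1 / ((m : ℝ) + 1) ≤ 1 := by rw [div_le_one hm]; linarith [Nat.cast_nonneg (α := ℝ) m]
    linarith) k
  have e : 1 + -(1 / ((m : ℝ) + 1)) = m / (m + 1) := by field_simp; ring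
  rw [e, div_pow, le_div_iff₀ (by positivity)] at h
  have h2 : 1 / ((m : ℝ) + 1) ≤ 1 + k * -(1 / ((m : ℝ) + 1)) := by
    rw [div_le_iff₀ hm]
    field_simp
    linarith
  have h3 := (mul_le_mul_of_nonneg_right h2 (pow_nonneg hm.le k)).trans h
  rw [div_mul_eq_mul_div, one_mul, div_le_iff₀ hm] at h3
  linarith

/-- A Gamma variable of integer shape `m + 1` exceeds `(m + 1) L` with probability at most
`(m + 1) exp (-L)`. -/
theorem exp_neg_mul_sum_le (m : ℕ) {L : ℝ} (hL : 0 ≤ L) :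
    Real.exp (-((m + 1) * L)) *
      ∑ k ∈ Finset.range (m + 1), ((m + 1) * L) ^ k / (k.factorial : ℝ) ≤
      (m + 1) * Real.exp (-L) := by
  have h : ∑ k ∈ Finset.range (m + 1), ((m + 1) * L) ^ k / (k.factorial : ℝ) ≤
      (m + 1) * Real.exp (m * L) := by
    refine le_trans ?_ (mul_le_mul_of_nonneg_left
      (Real.sum_le_exp_of_nonneg (by positivity : 0 ≤ (m : ℝ) * L) (m + 1)) (by positivity))
    rw [Finset.mul_sum]
    refine Finset.sum_le_sum fun k hk => ?_
    rw [mul_div_assoc', mul_pow, mul_pow, ← mul_assoc]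
    have := succ_pow_le_succ_mul_pow (Nat.lt_succ_iff.1 (Finset.mem_range.1 hk))
    gcongr
  refine (mul_le_mul_of_nonneg_left h (Real.exp_pos _).le).trans_eq ?_
  rw [mul_left_comm, ← Real.exp_add]
  ring_nf

/-- In polar coordinates `‖b‖` is a Gamma variable of shape `p` and rate `κ`. The radius `B`
satisfies `κ B = p L` with `L = log (p/π)`, so the tail is at most `p exp (-L) = π`. -/
theorem laplaceNoise_norm_gt_le {p : ℕ} (hp : 0 < p) {ζ₁ ζ₂ r ε π : ℝ} (hζ₁ : 0 < ζ₁)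
    (hζ₂ : 0 < ζ₂) (hr : 0 < r) (hε : 0 < ε) (hπ : π ∈ Set.Ioo (0 : ℝ) 1) :
    laplaceNoise p ζ₁ ζ₂ r ε {b | p * ζ₁ * ζ₂ * (r * ε)⁻¹ * Real.log (p * π⁻¹) < ‖b‖} ≤
      ENNReal.ofReal π := by
  obtain ⟨m, rfl⟩ : ∃ m, p = m + 1 := ⟨p - 1, by omega⟩
  have hπ0 := hπ.1
  set κ := (ζ₁ * ζ₂)⁻¹ * (r * ε) with hκdef
  have hκ : 0 < κ := by positivity
  set L := Real.log ((m + 1 : ℕ) * π⁻¹) with hLdef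
  have hL : 0 ≤ L := by
    refine Real.log_nonneg ?_
    have h1 : 1 ≤ π⁻¹ := (one_le_inv₀ hπ0).2 hπ.2.le
    push_cast
    nlinarith [Nat.cast_nonneg (α := ℝ) m]
  set B := (m + 1 : ℕ) * ζ₁ * ζ₂ * (r * ε)⁻¹ * L with hB
  have hB0 : 0 ≤ B := by positivity
  have hκB : κ * B = (m + 1) * L := by
    rw [hκdef, hB]; push_cast; field_simp
  have hint : Integrable fun x : Vec (m + 1) => Real.exp (-(κ * ‖x‖)) := by
    rw [integrable_fun_norm_addHaar (μ := volume) (f := fun y => Real.exp (-(κ * y)))]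
    simpa using integrableOn_pow_mul_exp_neg m hκ le_rfl
  set c := (volume : Measure (Vec (m + 1))).real (Metric.ball 0 1) with hc
  have hZ : ∫ x : Vec (m + 1), Real.exp (-(κ * ‖x‖)) =
      (m + 1) * c * ((m.factorial : ℝ) / κ ^ (m + 1)) := by
    rw [integral_fun_norm_addHaar volume fun y => Real.exp (-(κ * y))]
    simp only [finrank_euclideanSpace, Fintype.card_fin, add_tsub_cancel_right, smul_eq_mul]
    rw [integral_Ioi_pow_mul_exp_neg m hκ le_rfl, Finset.sum_range_succ']
    simp
    ring
  have hset : MeasurableSet {b : Vec (m + 1) | B < ‖b‖} := measurableSet_lt (by fun_prop) (by fun_prop)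
  have hT : ∫ x in {b : Vec (m + 1) | B < ‖b‖}, Real.exp (-(κ * ‖x‖)) =
      (m + 1) * c * ((m.factorial : ℝ) / κ ^ (m + 1) * (Real.exp (-((m + 1) * L)) *
        ∑ k ∈ Finset.range (m + 1), ((m + 1) * L) ^ k / (k.factorial : ℝ))) := by
    rw [← integral_indicator hset]
    have e : ({b : Vec (m + 1) | B < ‖b‖}.indicator fun x => Real.exp (-(κ * ‖x‖))) =
        fun x => (Set.Ioi B).indicator (fun y => Real.exp (-(κ * y))) ‖x‖ := by
      ext x
      simp [Set.indicator]
    rw [e, integral_fun_norm_addHaar volume]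
    simp only [finrank_euclideanSpace, Fintype.card_fin, add_tsub_cancel_right, smul_eq_mul]
    have e2 : (fun y : ℝ => y ^ m * (Set.Ioi B).indicator (fun y => Real.exp (-(κ * y))) y) =
        (Set.Ioi B).indicator fun y => y ^ m * Real.exp (-(κ * y)) := by
      ext y
      simp [Set.indicator]
    rw [e2, setIntegral_indicator measurableSet_Ioi, Set.Ioi_inter_Ioi, max_eq_right hB0,
      integral_Ioi_pow_mul_exp_neg m hκ hB0, hκB]
    simp
    ring
  have hZ0 : 0 ≤ ∫ x : Vec (m + 1), Real.exp (-(κ * ‖x‖)) :=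
    integral_nonneg fun x => (Real.exp_pos _).le
  rw [laplaceNoise, withDensity_apply _ hset, ← ofReal_integral_eq_lintegral_ofReal
    (hint.div_const _).integrableOn
    (ae_of_all _ fun x => div_nonneg (Real.exp_pos _).le hZ0), integral_div]
  refine ENNReal.ofReal_le_ofReal (div_le_of_le_mul₀ hZ0 hπ0.le ?_)
  rw [hT, hZ]
  have hexp : (m + 1) * Real.exp (-L) = π := by
    rw [hLdef, Real.exp_neg, Real.exp_log (by positivity)]
    push_cast
    field_simp
  have h := exp_neg_mul_sum_le m hL
  rw [hexp] at h
  calc _ ≤ (m + 1) * c * ((m.factorial : ℝ) / κ ^ (m + 1) * π) := by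
        have : 0 ≤ c := measureReal_nonneg
        gcongr
    _ = _ := by ring

/-! ### Tail of the Gaussian noise. -/

/-- The density at `u + t` is that at `u` times `exp (-ut - t²/2)`. Keeping the measure of `s'` lets
the two tails be added without a factor 2. -/
theorem gaussianReal_le_of_shift {s s' : Set ℝ} (hs : MeasurableSet s) (hs' : MeasurableSet s')
    (t : ℝ) (h : ∀ u, u + t ∈ s → u ∈ s' ∧ 0 ≤ u * t) :
    gaussianReal 0 1 s ≤ ENNReal.ofReal (Real.exp (-(t ^ 2 / 2))) * gaussianReal 0 1 s' := by
  rw [gaussianReal_apply _ one_ne_zero, gaussianReal_apply _ one_ne_zero, ← lintegral_indicator hs,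
    ← lintegral_indicator hs', ← lintegral_add_right_eq_self _ t,
    ← lintegral_const_mul _ ((measurable_gaussianPDF _ _).indicator hs')]
  refine lintegral_mono fun u => ?_
  by_cases hu : u + t ∈ s
  · rw [Set.indicator_of_mem hu, Set.indicator_of_mem (h u hu).1, gaussianPDF, gaussianPDF,
      ← ENNReal.ofReal_mul (Real.exp_pos _).le]
    refine ENNReal.ofReal_le_ofReal ?_
    rw [gaussianPDFReal_def]
    simp only [NNReal.coe_one, mul_one, sub_zero]
    rw [mul_left_comm, ← Real.exp_add]
    refine mul_le_mul_of_nonneg_left (Real.exp_le_exp.2 ?_) (by positivity)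
    nlinarith [(h u hu).2]
  · rw [Set.indicator_of_notMem hu]
    exact zero_le

theorem gaussianReal_abs_gt_le {x : ℝ} (hx : 0 ≤ x) :
    gaussianReal 0 1 {z | x < |z|} ≤ ENNReal.ofReal (Real.exp (-(x ^ 2 / 2))) := by
  have e : {z : ℝ | x < |z|} = Set.Ioi x ∪ Set.Iio (-x) := by
    ext z
    simp [lt_abs, lt_neg]
  have h1 := gaussianReal_le_of_shift (s := Set.Ioi x) (s' := Set.Ioi 0) measurableSet_Ioi
    measurableSet_Ioi x fun u hu => by
      have : 0 < u := by simpa using hu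
      exact ⟨this, mul_nonneg this.le hx⟩
  have h2 := gaussianReal_le_of_shift (s := Set.Iio (-x)) (s' := Set.Iio 0) measurableSet_Iio
    measurableSet_Iio (-x) fun u hu => by
      have : u < 0 := by simpa using hu
      exact ⟨this, mul_nonneg_of_nonpos_of_nonpos this.le (by linarith)⟩
  rw [neg_sq] at h2
  rw [e]
  refine (measure_union_le _ _).trans ((add_le_add h1 h2).trans ?_)
  have hdisj : Disjoint (Set.Ioi (0 : ℝ)) (Set.Iio 0) :=
    Set.disjoint_left.2 fun z hz hz' => lt_asymm (Set.mem_Ioi.1 hz) (Set.mem_Iio.1 hz')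
  rw [← mul_add, ← measure_union hdisj measurableSet_Iio]
  exact mul_le_of_le_one_right' prob_le_one

theorem integrable_exp_sq_div_three :
    Integrable (fun z : ℝ => Real.exp (z ^ 2 / 3)) (gaussianReal 0 1) ∧
      ∫ z, Real.exp (z ^ 2 / 3) ∂(gaussianReal 0 1) = √3 := by
  have e : (fun z : ℝ => gaussianPDFReal 0 1 z • Real.exp (z ^ 2 / 3)) =
      fun z => (√(2 * Real.pi))⁻¹ * Real.exp (-(1 / 6) * z ^ 2) := by
    ext z
    rw [gaussianPDFReal_def]
    simp only [NNReal.coe_one, mul_one, sub_zero, smul_eq_mul]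
    rw [mul_assoc, ← Real.exp_add]
    ring_nf
  constructor
  · rw [gaussianReal_of_var_ne_zero _ one_ne_zero, gaussianPDF_def,
      integrable_withDensity_iff_integrable_smul₀' (by fun_prop) (by simp)]
    have : (fun z : ℝ => (ENNReal.ofReal (gaussianPDFReal 0 1 z)).toReal • Real.exp (z ^ 2 / 3)) =
        fun z : ℝ => gaussianPDFReal 0 1 z • Real.exp (z ^ 2 / 3) := by
      ext z
      rw [ENNReal.toReal_ofReal (gaussianPDFReal_nonneg _ _ _)]
    rw [this, e]
    exact (integrable_exp_neg_mul_sq (by norm_num)).const_mul _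
  · rw [integral_gaussianReal_eq_integral_smul one_ne_zero, e, integral_const_mul,
      integral_gaussian, ← Real.sqrt_inv, ← Real.sqrt_mul (by positivity)]
    congr 1
    have := Real.pi_pos
    field_simp
    norm_num

/-- Amounts to `3 ≤ 2^1.6`, that is `3^5 = 243 ≤ 256 = 2^8`. -/
theorem three_mul_exp_le {L : ℝ} (hL : Real.log 2 ≤ L) :
    3 * Real.exp (-(2.6 * L)) ≤ Real.exp (-L) := by
  have h : (3 : ℝ) ≤ Real.exp (1.6 * L) := by
    refine le_of_pow_le_pow_left₀ (n := 5) (by norm_num) (Real.exp_pos _).le ?_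
    rw [← Real.exp_nat_mul]
    have : Real.exp (8 * Real.log 2) ≤ Real.exp ((5 : ℕ) * (1.6 * L)) :=
      Real.exp_le_exp.2 (by push_cast; linarith)
    refine le_trans ?_ this
    rw [mul_comm, Real.exp_mul, Real.exp_log two_pos]
    norm_num
  calc 3 * Real.exp (-(2.6 * L)) ≤ Real.exp (1.6 * L) * Real.exp (-(2.6 * L)) := by gcongr
    _ = Real.exp (-L) := by rw [← Real.exp_add]; ring_nf

theorem stdGaussian_norm_sq_gt_le {p : ℕ} (hp : 0 < p) {L : ℝ} (hL : Real.log 2 ≤ L) :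
    stdGaussian (Vec p) {x | p * (3.9 * L) < ‖x‖ ^ 2} ≤ ENNReal.ofReal (Real.exp (-L)) := by
  have hL0 : 0 < L := (Real.log_pos one_lt_two).trans_le hL
  have hset : MeasurableSet {x : Vec p | p * (3.9 * L) < ‖x‖ ^ 2} :=
    measurableSet_lt (by fun_prop) (by fun_prop)
  rw [← map_pi_eq_stdGaussian, Measure.map_apply (by fun_prop) hset]
  simp only [Set.preimage_ofPred_eq, EuclideanSpace.real_norm_sq_eq]
  -- For `p ≥ 2` the Chernoff bound with parameter `1/3` gives `(√3 exp (-1.3 L))^p`, at most its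
  -- value at `p = 2`. At `p = 1` it is too weak for `L` near `log 2`, and the sharp two-sided tail
  -- takes over.
  rcases Nat.lt_or_ge 1 p with h2 | h1
  · have hint : Integrable (fun x : Fin p → ℝ => ∏ i, Real.exp (x i ^ 2 / 3))
        (Measure.pi fun _ => gaussianReal 0 1) :=
      Integrable.fintype_prod (f := fun _ z => Real.exp (z ^ 2 / 3))
        fun _ => integrable_exp_sq_div_three.1
    have hval : ∫ x : Fin p → ℝ, ∏ i, Real.exp (x i ^ 2 / 3)
        ∂(Measure.pi fun _ => gaussianReal 0 1) = √3 ^ p := by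
      rw [integral_fintype_prod_eq_prod (f := fun _ z => Real.exp (z ^ 2 / 3))]
      simp [integrable_exp_sq_div_three.2]
    have hM := mul_meas_ge_le_integral_of_nonneg (ae_of_all _ fun x : Fin p → ℝ =>
      Finset.prod_nonneg fun i _ => (Real.exp_pos (x i ^ 2 / 3)).le) hint
      (Real.exp (p * (1.3 * L)))
    rw [hval] at hM
    have hle : (Measure.pi fun _ : Fin p => gaussianReal 0 1).real
        {x | p * (3.9 * L) < ∑ i, x i ^ 2} ≤ Real.exp (-L) := by
      have hmono : (Measure.pi fun _ : Fin p => gaussianReal 0 1).real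
          {x | p * (3.9 * L) < ∑ i, x i ^ 2} ≤ (Measure.pi fun _ : Fin p => gaussianReal 0 1).real
          {x | Real.exp (p * (1.3 * L)) ≤ ∏ i, Real.exp (x i ^ 2 / 3)} := by
        refine measureReal_mono fun x hx => ?_
        simp only [Set.mem_ofPred_eq] at hx ⊢
        rw [← Real.exp_sum, ← Finset.sum_div]
        exact Real.exp_le_exp.2 (by linarith)
      refine hmono.trans ?_
      have h3 : √3 * Real.exp (-(1.3 * L)) ≤ 1 := by
        have h := three_mul_exp_le hL
        have h' : Real.exp (-L) ≤ 1 := Real.exp_le_one_iff.2 (by linarith)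
        refine (sq_le_one_iff₀ (by positivity)).1 ?_
        rw [mul_pow, Real.sq_sqrt (by norm_num), ← Real.exp_nat_mul]
        push_cast
        rw [show 2 * -(1.3 * L) = -(2.6 * L) by ring]
        linarith
      calc _ ≤ Real.exp (-(p * (1.3 * L))) * √3 ^ p := by
            rw [Real.exp_neg, ← div_eq_inv_mul, le_div_iff₀ (Real.exp_pos _), mul_comm]
            exact hM
        _ = (√3 * Real.exp (-(1.3 * L))) ^ p := by
            rw [mul_pow, ← Real.exp_nat_mul, mul_comm, mul_neg]
        _ ≤ (√3 * Real.exp (-(1.3 * L))) ^ 2 := pow_le_pow_of_le_one (by positivity) h3 h2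
        _ = 3 * Real.exp (-(2.6 * L)) := by
            rw [mul_pow, Real.sq_sqrt (by norm_num), ← Real.exp_nat_mul]
            push_cast
            ring_nf
        _ ≤ _ := three_mul_exp_le hL
    rw [← ENNReal.ofReal_toReal (measure_ne_top _ _)]
    exact ENNReal.ofReal_le_ofReal hle
  · obtain rfl : p = 1 := by omega
    have hmp := measurePreserving_eval (fun _ : Fin 1 => gaussianReal 0 1) 0
    have h := gaussianReal_abs_gt_le (Real.sqrt_nonneg (3.9 * L))
    rw [Real.sq_sqrt (by positivity), ← hmp.measure_preimage
      (measurableSet_lt (by fun_prop) (by fun_prop)).nullMeasurableSet] at h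
    refine (measure_mono fun x hx => ?_).trans
      (h.trans (ENNReal.ofReal_le_ofReal (Real.exp_le_exp.2 (by linarith))))
    simp only [Nat.cast_one, one_mul, Finset.univ_unique, Fin.default_eq_zero, Finset.sum_singleton,
      Set.mem_ofPred_eq, Set.preimage_ofPred_eq, Function.eval] at hx ⊢
    rw [Real.sqrt_lt (by positivity) (abs_nonneg _), sq_abs]
    exact hx

theorem multivariateGaussian_smul_one (p : ℕ) {v : ℝ} (hv : 0 ≤ v) :
    multivariateGaussian (0 : Vec p) (v • (1 : Matrix (Fin p) (Fin p) ℝ)) =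
      (stdGaussian (Vec p)).map (fun x => √v • x) := by
  have hpos : (v • (1 : Matrix (Fin p) (Fin p) ℝ)).PosSemidef := Matrix.PosSemidef.one.smul hv
  refine Measure.ext_of_charFun ?_
  ext t
  have hdot : t.ofLp ⬝ᵥ t.ofLp = ‖t‖ ^ 2 := by
    rw [EuclideanSpace.real_norm_sq_eq, dotProduct]
    exact Finset.sum_congr rfl fun i _ => (sq _).symm
  rw [charFun_map_smul, charFun_stdGaussian, charFun_multivariateGaussian hpos, norm_smul,
    Matrix.smul_mulVec, Matrix.one_mulVec, dotProduct_smul, hdot, Real.norm_eq_abs,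
    abs_of_nonneg (Real.sqrt_nonneg v)]
  congr 1
  simp only [inner_zero_right, smul_eq_mul]
  push_cast
  rw [mul_pow, ← Complex.ofReal_pow √v, Real.sq_sqrt hv]
  simp [neg_div]

theorem laplaceConst_nonneg (p : ℕ) (ζ₁ ζ₂ r ε π : ℝ) : 0 ≤ laplaceConst p ζ₁ ζ₂ r ε π := by
  unfold laplaceConst; positivity

theorem laplaceNoise_norm_sq_gt_le {p : ℕ} (hp : 0 < p) {ζ₁ ζ₂ r ε π : ℝ} (hζ₁ : 0 < ζ₁)
    (hζ₂ : 0 < ζ₂) (hr : 0 < r) (hε : 0 < ε) (hπ : π ∈ Set.Ioo (0 : ℝ) 1) :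
    laplaceNoise p ζ₁ ζ₂ r ε {b | 1.95 * laplaceConst p ζ₁ ζ₂ r ε π < ‖b‖ ^ 2} ≤
      ENNReal.ofReal π := by
  refine (measure_mono fun b hb => ?_).trans (laplaceNoise_norm_gt_le hp hζ₁ hζ₂ hr hε hπ)
  simp only [Set.mem_ofPred_eq, laplaceConst] at hb ⊢
  refine lt_of_pow_lt_pow_left₀ 2 (norm_nonneg b) ?_
  nlinarith [sq_nonneg (p * ζ₁ * ζ₂ * (r * ε)⁻¹ * Real.log (p * π⁻¹))]

theorem gaussianConst_nonneg (p : ℕ) (ζ₁ ζ₂ : ℝ) {r ε δ π : ℝ} (hr : 0 < r) (hε : 0 < ε)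
    (hδ : δ ∈ Set.Ioo (0 : ℝ) 1) (hπ : π ∈ Set.Ioo (0 : ℝ) 1) :
    0 ≤ gaussianConst p ζ₁ ζ₂ r ε δ π := by
  have h1 : 0 ≤ Real.log (2 / δ) :=
    Real.log_nonneg ((one_le_div hδ.1).2 (by linarith [hδ.2]))
  have h2 : 0 ≤ Real.log π⁻¹ := Real.log_nonneg ((one_le_inv₀ hπ.1).2 hπ.2.le)
  unfold gaussianConst
  positivity

theorem gaussianNoise_norm_sq_gt_le {p : ℕ} (hp : 0 < p) {ζ₁ ζ₂ r ε δ π : ℝ} (hζ₁ : 0 < ζ₁)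
    (hζ₂ : 0 < ζ₂) (hr : 0 < r) (hε : 0 < ε) (hδ : δ ∈ Set.Ioo (0 : ℝ) 1)
    (hπ0 : 0 < π) (hπ : π ≤ 1 / 2) :
    gaussianNoise p ζ₁ ζ₂ r ε δ {b | 1.95 * gaussianConst p ζ₁ ζ₂ r ε δ π < ‖b‖ ^ 2} ≤
      ENNReal.ofReal π := by
  have hlogδ : Real.log δ < 0 := Real.log_neg hδ.1 hδ.2
  set v := 2 * ((r * ε) ^ 2)⁻¹ * ζ₁ ^ 2 * ζ₂ ^ 2 * (r * ε - Real.log δ) with hv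
  have hv0 : 0 < v := by
    have : 0 < r * ε - Real.log δ := by linarith [mul_pos hr hε]
    positivity
  have hL : Real.log 2 ≤ Real.log π⁻¹ :=
    Real.log_le_log two_pos ((le_inv_comm₀ two_pos hπ0).2 (by linarith))
  have hL0 : 0 < Real.log π⁻¹ := (Real.log_pos one_lt_two).trans_le hL
  have h := stdGaussian_norm_sq_gt_le hp hL
  rw [Real.log_inv, neg_neg, Real.exp_log hπ0, ← Real.log_inv] at h
  rw [gaussianNoise, ← hv, multivariateGaussian_smul_one p hv0.le,
    Measure.map_apply (by fun_prop) (measurableSet_lt (by fun_prop) (by fun_prop))]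
  refine (measure_mono fun x hx => ?_).trans h
  simp only [Set.mem_ofPred_eq, Set.preimage_ofPred_eq] at hx ⊢
  rw [norm_smul, mul_pow, Real.norm_eq_abs, sq_abs, Real.sq_sqrt hv0.le] at hx
  -- The gap is the `log 2` in `log (2/δ)`; `3.9 = 2 · 1.95` matches the chi-square bound.
  have hC : 2 * p * v * Real.log π⁻¹ ≤ gaussianConst p ζ₁ ζ₂ r ε δ π := by
    rw [gaussianConst, hv, Real.log_div two_ne_zero hδ.1.ne']
    have h2 : 0 ≤ 4 * p * ζ₁ ^ 2 * ζ₂ ^ 2 * ((r * ε) ^ 2)⁻¹ * Real.log 2 * Real.log π⁻¹ := by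
      have := Real.log_pos one_lt_two
      positivity
    linarith
  refine lt_of_mul_lt_mul_left ?_ hv0.le
  linarith

/-! ### Convexity and the deterministic argument. -/

theorem regularizer_nonneg {p : ℕ} (ne : ℕ) {l2 : ℝ} (hl2 : 0 ≤ l2) {V : Fin p → ℝ}
    (hV : ∀ j, 0 ≤ V j) (θ : Vec p) : 0 ≤ regularizer ne l2 V θ :=
  mul_nonneg (by positivity) (Finset.sum_nonneg fun j _ => mul_nonneg (hV j) (sq_nonneg _))

theorem regularizer_segment {p : ℕ} (ne : ℕ) (l2 : ℝ) (V : Fin p → ℝ) (θ θ' : Vec p) (a : ℝ) :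
    regularizer ne l2 V ((1 - a) • θ + a • θ') =
      (1 - a) * regularizer ne l2 V θ + a * regularizer ne l2 V θ' -
        a * (1 - a) * regularizer ne l2 V (θ - θ') := by
  simp only [regularizer, PiLp.add_apply, PiLp.smul_apply, PiLp.sub_apply, smul_eq_mul,
    Finset.mul_sum, ← Finset.sum_add_distrib, ← Finset.sum_sub_distrib]
  refine Finset.sum_congr rfl fun j _ => ?_
  ring

theorem modulus_pos {p : ℕ} (hp : 0 < p) {ne : ℕ} (hne : 0 < ne) {l2 : ℝ} (hl2 : 0 < l2)
    {V : Fin p → ℝ} (hV : ∀ j, 0 < V j) : 0 < modulus ne l2 V := by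
  have : Nonempty (Fin p) := ⟨⟨0, hp⟩⟩
  obtain ⟨j, hj⟩ := exists_eq_ciInf_of_finite (f := V)
  rw [modulus, ← hj]
  have := hV j
  positivity

theorem modulus_mul_norm_sq_le {p : ℕ} (ne : ℕ) {l2 : ℝ} (hl2 : 0 ≤ l2) (V : Fin p → ℝ)
    (θ : Vec p) : modulus ne l2 V / 2 * ‖θ‖ ^ 2 ≤ regularizer ne l2 V θ := by
  rw [EuclideanSpace.real_norm_sq_eq, modulus, regularizer]
  calc _ = 2⁻¹ * (ne * l2) * ∑ j, (⨅ j, V j) * θ j ^ 2 := by rw [← Finset.mul_sum]; ring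
    _ ≤ _ := by
      refine mul_le_mul_of_nonneg_left (Finset.sum_le_sum fun j _ => ?_) (by positivity)
      exact mul_le_mul_of_nonneg_right (ciInf_le (Set.finite_range V).bddBelow j) (sq_nonneg _)

/-- Strong convexity of the private objective at its minimizer, in the metric of the
regularizer. -/
theorem privObjective_minimizer_le {p n : ℕ} {Y : Type*} {Θ : Set (Vec p)} (hΘ : Convex ℝ Θ)
    {φ : Y → ℝ → ℝ} (hφ : ∀ y, ConvexOn ℝ Set.univ (φ y)) (hn : 0 < n) (D : Fin n → Vec p × Y)
    (b : Vec p) (ne : ℕ) (l2 : ℝ) (V : Fin p → ℝ) {θ θ₀ : Vec p} (hθ : θ ∈ Θ) (hθ₀ : θ₀ ∈ Θ)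
    (hmin : IsMinOn (privObjective φ D b ne l2 V) Θ θ) :
    ∑ i, loss φ θ (D i) + inner ℝ b (θ - θ₀) + regularizer ne l2 V θ +
      regularizer ne l2 V (θ - θ₀) ≤ ∑ i, loss φ θ₀ (D i) + regularizer ne l2 V θ₀ := by
  have hn' : (0 : ℝ) < n := by exact_mod_cast hn
  have hinner : ∀ w : Vec p, ∑ j, b j * w j = inner ℝ b w := fun w => by
    simp [PiLp.inner_apply, mul_comm]
  -- Minimality is tested at `(1 - a)θ + aθ₀` and divided by `a`; the limit `a → 0` restores the
  -- full `R(θ - θ₀)`.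
  have key : ∀ a ∈ Set.Ioo (0 : ℝ) 1, ∑ i, loss φ θ (D i) + inner ℝ b (θ - θ₀) +
      regularizer ne l2 V θ + (1 - a) * regularizer ne l2 V (θ - θ₀) ≤
        ∑ i, loss φ θ₀ (D i) + regularizer ne l2 V θ₀ := by
    rintro a ⟨ha0, ha1⟩
    have hmem : (1 - a) • θ + a • θ₀ ∈ Θ := hΘ hθ hθ₀ (by linarith) ha0.le (by ring)
    have h := isMinOn_iff.1 hmin _ hmem
    simp only [privObjective, hinner] at h
    have h1 := le_of_mul_le_mul_left h (inv_pos.2 hn')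
    have h2 : ∑ i, loss φ ((1 - a) • θ + a • θ₀) (D i) ≤
        (1 - a) * ∑ i, loss φ θ (D i) + a * ∑ i, loss φ θ₀ (D i) := by
      rw [Finset.mul_sum, Finset.mul_sum, ← Finset.sum_add_distrib]
      refine Finset.sum_le_sum fun i _ => ?_
      have := (hφ (D i).2).2 (Set.mem_univ (inner ℝ (D i).1 θ)) (Set.mem_univ (inner ℝ (D i).1 θ₀))
        (by linarith : 0 ≤ 1 - a) ha0.le (by ring)
      simpa [loss, inner_add_right, inner_smul_right] using this
    rw [regularizer_segment, inner_add_right, inner_smul_right, inner_smul_right] at h1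
    rw [inner_sub_right]
    refine le_of_mul_le_mul_left ?_ ha0
    linarith
  by_contra hcon
  push Not at hcon
  have hlim : Filter.Tendsto (fun a : ℝ => ∑ i, loss φ θ (D i) + inner ℝ b (θ - θ₀) +
      regularizer ne l2 V θ + (1 - a) * regularizer ne l2 V (θ - θ₀)) (nhdsWithin 0 (Set.Ioi 0))
      (nhds (∑ i, loss φ θ (D i) + inner ℝ b (θ - θ₀) +
      regularizer ne l2 V θ + (1 - 0) * regularizer ne l2 V (θ - θ₀))) :=
    ((by fun_prop : Continuous fun a : ℝ => ∑ i, loss φ θ (D i) + inner ℝ b (θ - θ₀) +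
      regularizer ne l2 V θ + (1 - a) * regularizer ne l2 V (θ - θ₀)).tendsto 0).mono_left
      nhdsWithin_le_nhds
  have := le_of_tendsto hlim (Filter.eventually_of_mem
    (Ioo_mem_nhdsGT one_pos) key)
  linarith

/-- Lower bound for `R(θ)` in terms of `R(θ₀)` and `R(θ - θ₀)`, from Young's inequality. -/
theorem regularizer_ge {p : ℕ} (ne : ℕ) {l2 : ℝ} (hl2 : 0 ≤ l2) {V : Fin p → ℝ}
    (hV : ∀ j, 0 ≤ V j) (θ θ₀ : Vec p) :
    regularizer ne l2 V θ₀ / 200 - regularizer ne l2 V (θ - θ₀) / 199 ≤ regularizer ne l2 V θ := by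
  simp only [regularizer, PiLp.sub_apply, Finset.mul_sum, Finset.sum_div,
    ← Finset.sum_sub_distrib]
  refine Finset.sum_le_sum fun j _ => ?_
  have h : 0 ≤ 2⁻¹ * (ne * l2) * V j := mul_nonneg (by positivity) (hV j)
  have h2 := mul_nonneg h (sq_nonneg (200 * θ j - θ₀ j))
  linarith

/-- The deterministic part: an excess loss above `ϱ` forces a large deviation of the excess
empirical loss. -/
theorem deviation_of_excess {p n : ℕ} {Y : Type*} {Θ : Set (Vec p)} (hΘ : Convex ℝ Θ)
    {φ : Y → ℝ → ℝ} (hφ : ∀ y, ConvexOn ℝ Set.univ (φ y)) (hn : 0 < n) (hp : 0 < p)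
    (D : Fin n → Vec p × Y) (b : Vec p) {ne : ℕ} (hne : 0 < ne) {l2 : ℝ} (hl2 : 0 < l2)
    {V : Fin p → ℝ} (hV : ∀ j, 0 < V j) {θ θ₀ : Vec p} (hθ : θ ∈ Θ) (hθ₀ : θ₀ ∈ Θ)
    (hmin : IsMinOn (privObjective φ D b ne l2 V) Θ θ) {C K ϱ Δ : ℝ} (hϱ : 0 < ϱ) (hK : 0 < K)
    (hC : 0 ≤ C)
    (hb : ‖b‖ ^ 2 ≤ 1.95 * C) (hpos : 0 < ϱ - K * (2 * modulus ne l2 V)⁻¹)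
    (hthr : (ϱ - K * (2 * modulus ne l2 V)⁻¹)⁻¹ *
      (regularizer ne l2 V θ₀ + C * (modulus ne l2 V)⁻¹) < n) (hΔ : ϱ < Δ) :
    n * ϱ / 200 + K / (1000 * ϱ) * ‖θ - θ₀‖ ^ 2 <
      n * Δ - (∑ i, loss φ θ (D i) - ∑ i, loss φ θ₀ (D i)) := by
  have hn' : (0 : ℝ) < n := by exact_mod_cast hn
  have hm := modulus_pos hp hne hl2 hV
  set m := modulus ne l2 V with hmdef
  have hmin' := privObjective_minimizer_le hΘ hφ hn D b ne l2 V hθ hθ₀ hmin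
  have hR := regularizer_ge ne hl2.le (fun j => (hV j).le) θ θ₀
  have hu := modulus_mul_norm_sq_le ne hl2.le V (θ - θ₀)
  have hR0 := regularizer_nonneg ne hl2.le (fun j => (hV j).le) θ₀
  rw [← hmdef] at hu
  set u := regularizer ne l2 V (θ - θ₀)
  set d := ‖θ - θ₀‖ with hd
  have hthr' : regularizer ne l2 V θ₀ + C / m < n * (ϱ - K / (2 * m)) := by
    rw [inv_mul_lt_iff₀ hpos] at hthr
    simp only [div_eq_mul_inv]
    linarith
  have hKm : K / (2 * m) < ϱ := by rw [div_eq_mul_inv]; linarith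
  have hnK : 0 < n * (K / (2 * m)) := by positivity
  have hinner : -(‖b‖ * d) ≤ inner ℝ b (θ - θ₀) := neg_le_of_abs_le (abs_real_inner_le_norm _ _)
  -- Young's inequality with weight 0.99 leaves part of `R(θ - θ₀)` unspent; `1.95 ≤ 0.985 · 1.98`
  -- leaves part of `C/m`.
  have hbd : ‖b‖ * d ≤ 0.99 * (m / 2 * d ^ 2) + 0.985 * (C / m) := by
    have h1 : ‖b‖ * d ≤ 0.99 * (m / 2 * d ^ 2) + ‖b‖ ^ 2 / (1.98 * m) := by
      have h2 : 0.99 * (m / 2 * d ^ 2) + ‖b‖ ^ 2 / (1.98 * m) - ‖b‖ * d =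
          (0.99 * m * d - ‖b‖) ^ 2 / (1.98 * m) := by
        field_simp
        ring
      have h3 : 0 ≤ (0.99 * m * d - ‖b‖) ^ 2 / (1.98 * m) := by positivity
      linarith
    have h4 : ‖b‖ ^ 2 / (1.98 * m) ≤ 0.985 * (C / m) := by
      rw [div_le_iff₀ (by positivity), show 0.985 * (C / m) * (1.98 * m) = 0.985 * 1.98 * C by
        field_simp]
      linarith
    linarith
  have hKd : K / (1000 * ϱ) * d ^ 2 ≤ m / 500 * d ^ 2 := by
    refine mul_le_mul_of_nonneg_right ?_ (sq_nonneg d)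
    rw [div_lt_iff₀ (by positivity)] at hKm
    rw [div_le_iff₀ (by positivity)]
    linarith
  have hCm : 0 ≤ C / m := by positivity
  have hΔ' : n * ϱ < n * Δ := mul_lt_mul_of_pos_left hΔ hn'
  have hw : 0 ≤ m / 2 * d ^ 2 := by positivity
  rw [show m / 500 * d ^ 2 = 0.004 * (m / 2 * d ^ 2) by ring] at hKd
  rw [mul_sub] at hthr'
  generalize m / 2 * d ^ 2 = w at *
  generalize C / m = c at *
  generalize n * (K / (2 * m)) = k at *
  generalize K / (1000 * ϱ) * d ^ 2 = q at *
  norm_num at hbd hKd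
  -- `R(θ₀)` and `C/m` carry coefficients at most `199/200`, which leaves `nϱ/200`; the quadratic
  -- term keeps `198/199 - 0.99 > 0.004`.
  linarith

/-! ### The good event and the theorem. -/

/-- The deviation event is a union over all of `Θ` and need not be known measurable, so the
complement of a measurable hull is taken. -/
theorem exists_measurableSet_disjoint {Ω : Type*} [MeasurableSpace Ω] (P : Measure Ω)
    [IsProbabilityMeasure P] {s t : Set Ω} {a b : ℝ} (ha : 0 ≤ a) (hb : 0 ≤ b)
    (hs : P s ≤ ENNReal.ofReal a) (ht : P t ≤ ENNReal.ofReal b) :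
    ∃ G : Set Ω, MeasurableSet G ∧ 1 - a - b ≤ P.real G ∧ ∀ ω ∈ G, ω ∉ s ∧ ω ∉ t := by
  refine ⟨(toMeasurable P (s ∪ t))ᶜ, (measurableSet_toMeasurable _ _).compl, ?_, fun ω hω => ?_⟩
  · rw [probReal_compl_eq_one_sub (measurableSet_toMeasurable _ _), measureReal_def,
      measure_toMeasurable]
    have h : P (s ∪ t) ≤ ENNReal.ofReal (a + b) := by
      rw [ENNReal.ofReal_add ha hb]
      exact (measure_union_le _ _).trans (add_le_add hs ht)
    linarith [ENNReal.toReal_le_of_le_ofReal (add_nonneg ha hb) h]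
  · have h : ω ∉ s ∪ t := fun h => hω (subset_toMeasurable _ _ h)
    exact ⟨fun hs => h (Or.inl hs), fun ht => h (Or.inr ht)⟩

theorem _root_.ProbabilityTheory.HasLaw.measure_preimage_le {Ω 𝓧 : Type*} [MeasurableSpace Ω]
    [MeasurableSpace 𝓧] {X : Ω → 𝓧} {μ : Measure 𝓧} {P : Measure Ω} (hX : HasLaw X μ P)
    (s : Set 𝓧) : P {ω | X ω ∈ s} ≤ μ s := by
  rw [← hX.map_eq]
  exact Measure.le_map_apply hX.aemeasurable s

end NAPP

theorem theorem10 (ζ₁ ζ₂ πmax : ℝ) (hζ₁ : 0 < ζ₁) (hζ₂ : 0 < ζ₂)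
    (hπmax : πmax ∈ Set.Ioo (0 : ℝ) 1) :
    -- the constant depends on nothing that is quantified below
    ∃ C' : ℝ, 0 < C' ∧
    ∀ (p n ne t : ℕ) (_ : 0 < p) (_ : 0 < ne) (_ : 1 ≤ t)
      -- parameter set, loss, and the law of one data point
      (Θ : Set (NAPP.Vec p)) (_ : Convex ℝ Θ) (_ : IsClosed Θ)
      (Y : Type*) (_ : MeasurableSpace Y) (φ : Y → ℝ → ℝ)
      (_ : ∀ y, ConvexOn ℝ Set.univ (φ y)) (_ : ∀ y, ContDiff ℝ 2 (φ y))
      (_ : ∀ η, Measurable fun y => φ y η)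
      (μ : Measure (NAPP.Vec p × Y)) (_ : IsProbabilityMeasure μ)
      (_ : ∀ᵐ d ∂μ, ‖d.1‖ ≤ ζ₁ ∧ ∀ θ ∈ Θ, ‖gradient (fun θ' => NAPP.loss φ θ' d) θ‖ < ζ₂)
      (_ : ∀ θ ∈ Θ, Integrable (NAPP.loss φ θ) μ)
      -- minimizer of the expected loss
      (θ₀ : NAPP.Vec p) (_ : θ₀ ∈ Θ) (_ : IsMinOn (NAPP.expectedLoss φ μ n) Θ θ₀)
      -- outcomes of the augmented rows, second derivative of their loss at `0`, variances
      (ey : Fin ne → Y) (l2 : ℝ) (_ : 0 < l2) (_ : ∀ i, iteratedDeriv 2 (φ (ey i)) 0 = l2)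
      (V₁ : Fin p → ℝ) (_ : ∀ j, 0 < V₁ j)
      (V : NAPP.Vec p → Fin p → ℝ) (_ : ∀ θ j, 0 < V θ j)
      -- privacy and confidence parameters
      (r ε π π' : ℝ) (_ : r ∈ Set.Ioo (0 : ℝ) 1) (_ : 0 < ε)
      (_ : π ∈ Set.Ioo (0 : ℝ) 1) (_ : π' ∈ Set.Ioc (0 : ℝ) πmax)
      -- independent data points, and privacy noise independent of them
      (Ω : Type*) (_ : MeasurableSpace Ω) (P : Measure Ω) (_ : IsProbabilityMeasure P)
      (D : Fin n → Ω → NAPP.Vec p × Y) (_ : ∀ i, HasLaw (D i) μ P) (_ : iIndepFun D P)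
      (b : Ω → NAPP.Vec p) (_ : IndepFun b (fun ω i => D i ω) P)
      (C : ℝ)
      (_ : (HasLaw b (NAPP.laplaceNoise p ζ₁ ζ₂ r ε) P ∧ C = NAPP.laplaceConst p ζ₁ ζ₂ r ε π) ∨
        (∃ δ ∈ Set.Ioo (0 : ℝ) 1, HasLaw b (NAPP.gaussianNoise p ζ₁ ζ₂ r ε δ) P ∧
          C = NAPP.gaussianConst p ζ₁ ζ₂ r ε δ π ∧ π ≤ 1 / 2))
      -- private estimates of iterations `1, …, t`
      (est : ℕ → Ω → NAPP.Vec p)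
      (_ : ∀ ω, NAPP.IsRun Θ φ (fun i => D i ω) (b ω) ne l2 V₁ V t (fun s => est s ω))
      (ϱ : ℝ) (_ : 0 < ϱ),
      -- The variances of iteration `t`, hence the threshold, are random if `2 ≤ t`.
      ∃ G : Set Ω, MeasurableSet G ∧ 1 - π' - π ≤ P.real G ∧
        ∀ ω ∈ G, ∀ Vt : Fin p → ℝ, Vt = NAPP.iterVariance V₁ V (fun s => est s ω) t →
          0 < ϱ + C' * Real.log π' * (2 * NAPP.modulus ne l2 Vt)⁻¹ →
          (n : ℝ) > (ϱ + C' * Real.log π' * (2 * NAPP.modulus ne l2 Vt)⁻¹)⁻¹ *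
            (NAPP.regularizer ne l2 Vt θ₀ + C * (NAPP.modulus ne l2 Vt)⁻¹) →
          NAPP.expectedLoss φ μ n (est t ω) ≤ NAPP.expectedLoss φ μ n θ₀ + ϱ := by

  obtain ⟨hπm0, hπm1⟩ := hπmax
  have hlm : 0 < -Real.log πmax := neg_pos.2 (Real.log_neg hπm0 hπm1)
  -- Chosen so that `A λ ≥ λ + 1/2` for `λ = -log π'` and every `π' ≤ πmax`; this absorbs the `exp
  -- (1/2)` of the moment bound.
  set A : ℝ := 1 + 1 / (2 * -Real.log πmax) with hA
  have hA0 : 0 < A := by positivity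
  refine ⟨800000 * ζ₂ ^ 2 * A, by positivity, ?_⟩
  intro p n ne t hp hne ht Θ hΘ hΘc Y _ φ hφ hφ2 hφm μ _ hμ hint θ₀ hθ₀ hθ₀min ey l2 hl2 hey V₁ hV₁
    V hV r ε π π' hr hε hπ hπ' Ω _ P _ D hD hDind b hbind C hC est hest ϱ hϱ
  have hC0 : 0 ≤ C := by
    rcases hC with ⟨_, rfl⟩ | ⟨δ, hδ, _, rfl, _⟩
    · exact NAPP.laplaceConst_nonneg _ _ _ _ _ _
    · exact NAPP.gaussianConst_nonneg _ _ _ hr.1 hε hδ hπ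
  have hVt : ∀ ω j, 0 < NAPP.iterVariance V₁ V (fun s => est s ω) t j := by
    intro ω j
    unfold NAPP.iterVariance
    split_ifs
    · exact hV₁ j
    · exact hV _ j
  -- The threshold is nonnegative, so the sample size condition fails at `n = 0`.
  rcases Nat.eq_zero_or_pos n with rfl | hn
  · refine ⟨Set.univ, MeasurableSet.univ, ?_, ?_⟩
    · rw [probReal_univ]
      linarith [hπ.1, hπ'.1]
    · rintro ω - Vt rfl hpos hthr
      have hm := NAPP.modulus_pos hp hne hl2 (hVt ω)
      have hR0 := NAPP.regularizer_nonneg ne hl2.le (fun j => (hVt ω j).le) θ₀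
      rw [Nat.cast_zero] at hthr
      exact absurd hthr (not_lt.2 (mul_nonneg (inv_nonneg.2 hpos.le) (by positivity)))
  have hn' : (0 : ℝ) < n := by exact_mod_cast hn
  set lam : ℝ := -Real.log π' with hlam
  have hlamle : -Real.log πmax ≤ lam := neg_le_neg (Real.log_le_log hπ'.1 hπ'.2)
  have hlam0 : 0 < lam := hlm.trans_le hlamle
  set K : ℝ := 800000 * ζ₂ ^ 2 * A * lam with hK
  have hK0 : 0 < K := by positivity
  -- Makes the quadratic part of the allowance `K/(1000ϱ)`; the factor `800000 = 4000 · 200` in `C'`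
  -- then makes the constant part `nϱ/200`.
  set η : ℝ := K / (4000 * ζ₂ ^ 2 * n * ϱ) with hη
  have hη0 : 0 < η := by positivity
  have hdev := NAPP.measure_pi_excess_deviation_le (n := n) hΘ
    (fun y => (hφ2 y).differentiable two_ne_zero) hφm hζ₂ (hμ.mono fun d hd => hd.2) hint hθ₀ hn hη0
    (A * lam)
  have hs1 : A * lam / η = n * ϱ / 200 := by
    rw [hη, hK]
    field_simp
    norm_num
  have hs2 : 4 * n * η * ζ₂ ^ 2 = K / (1000 * ϱ) := by
    rw [hη]
    field_simp
    norm_num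
  have hexp : Real.exp (1 / 2 - A * lam) ≤ π' := by
    rw [← Real.exp_log hπ'.1]
    refine Real.exp_le_exp.2 ?_
    have h1 : 1 / 2 ≤ 1 / (2 * -Real.log πmax) * lam := by
      rw [div_mul_eq_mul_div, one_mul, div_le_div_iff₀ two_pos (by positivity)]
      linarith
    have h2 : A * lam = lam + 1 / (2 * -Real.log πmax) * lam := by rw [hA]; ring
    linarith
  rw [hs1, hs2] at hdev
  have hdata := ((hDind.hasLaw_pi hD).measure_preimage_le _).trans
    (hdev.trans (ENNReal.ofReal_le_ofReal hexp))
  have hnoise : P {ω | b ω ∈ {x : NAPP.Vec p | 1.95 * C < ‖x‖ ^ 2}} ≤ ENNReal.ofReal π := by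
    rcases hC with ⟨hb, rfl⟩ | ⟨δ, hδ, hb, rfl, hπ2⟩
    · exact (hb.measure_preimage_le _).trans
        (NAPP.laplaceNoise_norm_sq_gt_le hp hζ₁ hζ₂ hr.1 hε hπ)
    · exact (hb.measure_preimage_le _).trans
        (NAPP.gaussianNoise_norm_sq_gt_le hp hζ₁ hζ₂ hr.1 hε hδ hπ.1 hπ2)
  obtain ⟨G, hG, hPG, hGω⟩ := NAPP.exists_measurableSet_disjoint P hπ'.1.le hπ.1.le hdata hnoise
  refine ⟨G, hG, hPG, ?_⟩
  rintro ω hω Vt rfl hpos hthr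
  obtain ⟨h1, h2⟩ := hGω ω hω
  simp only [Set.mem_ofPred_eq, not_exists, not_and, not_lt] at h1 h2
  obtain ⟨hmem, hmin⟩ := hest ω t ht le_rfl
  have e : 800000 * ζ₂ ^ 2 * A * Real.log π' = -K := by rw [hK, hlam]; ring
  rw [e, neg_mul, ← sub_eq_add_neg] at hpos hthr
  rw [NAPP.expectedLoss_eq_integral hn (hint _ hmem), NAPP.expectedLoss_eq_integral hn (hint _ hθ₀)]
  by_contra hcon
  push Not at hcon
  have h3 := NAPP.deviation_of_excess hΘ hφ hn hp (fun i => D i ω) (b ω) hne hl2 (hVt ω) hmem hθ₀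
    hmin hϱ hK0 hC0 h2 hpos hthr (lt_sub_iff_add_lt'.2 hcon)
  exact absurd (h1 _ hmem) (not_le.2 h3)
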